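/- For a finite metric space $X$, let $z_X(q)=\bigl(q^{d(x,y)}\bigr)_{x,y\in X}$, regarded as a matrix over the field of generalized rational functions in $q$, that is, the fraction field of the ring of generalized polynomials $\sum_a c_a q^a$ (finite sums, with arbitrary real exponents $a\ge 0$ and real coefficients). Its determinant has constant term $1$, so $z_X(q)$ is invertible; the sum $m_X(q)$ of all the entries of $z_X(q)^{-1}$ is called the formal magnitude of $X$. A finite metric space $A$ is said to be identified by its formal magnitude if every finite metric space $X$ with $m_X(q)=m_A(q)$ is isometric to $A$. The regular $n$-gon is the set of the $n$ vertices of the regular $n$-gon of side length $1$ in the Euclidean plane, with the Euclidean distance; the $n$-cycle graph is regarded as the metric space of its $n$ vertices with the shortest-path distance (edges of length $1$). (1) If $n\in\{4,5,7\}$, then the regular $n$-gon is identified by its formal magnitude. (2) If $n=9$, or $n\ge 6$ is even, then the regular $n$-gon is not identified by its formal magnitude, i.e. there is a finite metric space that has the same formal magnitude as the regular $n$-gon but is not isometric to it. (3) If $n\in\{4,5\}$, then the $n$-cycle graph is identified by its formal magnitude. (4) If $n\ge 6$ is even, then the $n$-cycle graph is not identified by its formal magnitude, i.e. there is a finite metric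 space that has the same formal magnitude as the $n$-cycle graph but is not isometric to it. -/

import Mathlib

open scoped NNReal

universe u v

noncomputable section

/-- Generalized polynomials in one variable `q`: finite sums `∑ c_a q ^ a` with real coefficients
and arbitrary real exponents `a ≥ 0`. -/
abbrev GenPoly : Type := AddMonoidAlgebra ℝ ℝ≥0

/-- The field of generalized rational functions in `q`: the fraction field of the domain of
generalized polynomials. -/
abbrev GenRat : Type := FractionRing GenPoly

/-- The power `q ^ a` as a generalized rational function. -/
def qpow (a : ℝ≥0) : GenRat := algebraMap GenPoly GenRat (AddMonoidAlgebra.single a 1)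

/-- The matrix `z_X(q) = (q ^ d(x, y))` of a finite metric space `X`. -/
def zMatrix (X : Type u) [MetricSpace X] : Matrix X X GenRat :=
  Matrix.of fun x y => qpow (nndist x y)

open scoped Classical in
/-- The formal magnitude of a finite metric space: the sum of all entries of `z_X(q)⁻¹`. -/
def formalMagnitude (X : Type u) [MetricSpace X] [Fintype X] : GenRat :=
  ∑ x : X, ∑ y : X, (zMatrix X)⁻¹ x y

/-- A finite metric space `A` is identified by its formal magnitude if every finite metric space
with the same formal magnitude is isometric to `A`. -/
def IdentifiedByFormalMagnitude (A : Type v) [MetricSpace A] [Fintype A] : Prop :=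
  ∀ (X : Type u) [MetricSpace X] [Fintype X],
    formalMagnitude X = formalMagnitude A → Nonempty (X ≃ᵢ A)

/-- The `k`-th vertex of the regular `n`-gon with side length `1`, placed on the circle of radius
`1 / (2 sin (π / n))` around the origin of the Euclidean plane. -/
def regularPolygonVertex (n : ℕ) (k : Fin n) : EuclideanSpace ℝ (Fin 2) :=
  !₂[Real.cos (2 * Real.pi * (k : ℕ) / n) / (2 * Real.sin (Real.pi / n)),
    Real.sin (2 * Real.pi * (k : ℕ) / n) / (2 * Real.sin (Real.pi / n))]

/-- The regular `n`-gon: the set of vertices of the regular `n`-gon of side length `1`, with the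
metric of the Euclidean plane. -/
abbrev RegularPolygon (n : ℕ) : Type := Set.range (regularPolygonVertex n)

instance instFintypeRegularPolygon (n : ℕ) : Fintype (RegularPolygon n) := Fintype.ofFinite _

/-- The vertices of the `n`-cycle graph, regarded below as the points of a metric space. -/
@[ext]
structure CycleSpace (n : ℕ) : Type where
  vertex : Fin n

instance instFintypeCycleSpace (n : ℕ) : Fintype (CycleSpace n) :=
  Fintype.ofEquiv (Fin n) ⟨CycleSpace.mk, CycleSpace.vertex, fun _ => rfl, fun _ => rfl⟩

/-- The shortest-path metric on the `n`-cycle graph (every edge has length `1`). -/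
instance instMetricSpaceCycleSpace (n : ℕ) : MetricSpace (CycleSpace n) where
  dist x y := ((SimpleGraph.cycleGraph n).dist x.vertex y.vertex : ℝ)
  dist_self x := by simp
  dist_comm x y := by rw [SimpleGraph.dist_comm]
  dist_triangle x y z := by
    exact_mod_cast
      (SimpleGraph.cycleGraph_preconnected x.vertex y.vertex).dist_triangle_left z.vertex
  eq_of_dist_eq_zero {x y} h :=
    CycleSpace.ext ((SimpleGraph.cycleGraph_preconnected x.vertex y.vertex).dist_eq_zero_iff.mp
      (by exact_mod_cast h))

end

open scoped NNReal

/-! ### Lowest-order terms of generalized polynomials -/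

noncomputable section

/-! Let `A` be homogeneous with `n` points and common row sum `r`. Then the magnitude of `A` is `n /
r`, so any other space with `n` points and constant row sum `r` has the same magnitude. All the
counterexamples arise this way. They are abelian groups with a translation-invariant metric having
the same multiset of lengths as `ZMod n`: two layers `ZMod 2 × ZMod m` for `n = 2 * m`, and `ZMod 3
× ZMod 3` for the 9-gon, where the identity `chord_nine_four` saves the triangle inequality.

For the positive results, let `X` have the magnitude of `A`. Constant terms give `card X = n`. Write
`D` for the determinant of the matrix of `X`, `T` for its total, `δ x` for `n` times the row sum at
`x` minus `T`, and `Q` for the quadratic form of the adjugate at `δ`. Then `n D T (T - n r) = r Q`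
(`totalPoly_sub_eq`). If `δ ≠ 0` has least exponent `e`, the leading term of `Q` is a sum of real
squares at `2e`, since the adjugate is the identity up to higher order. So `T` and `n r` agree below
`2e`, and `T` has the strictly larger coefficient at `2e`. Both have coefficient sum `n ^ 2`, so
some distance of `A` beyond `2e` would have to occur too rarely in `X`. When the nonzero distances
of `A` are `1` or lie in `[s, 1 + s)` with `1 < s ≤ 2`, this forces `e = 1`, and an estimate of the
next terms of `Q` shows that `T - n r` vanishes at those distances, a contradiction
(`rowPoly_eq_of_formalMagnitude_eq`). Hence every row sum of `X` equals `r`.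

It remains to reconstruct `X` from its row sums. The pairs at distance `1` form a two-regular graph.
With at most five points it is a single cycle, which determines the metric. With seven points the
triangle inequality `D 3 > 2` fixes the distance between vertices two steps apart on a cycle, and
double counting excludes a 4-cycle together with a triangle. -/

/-- The ideal of generalized polynomials all of whose exponents are at least `c`. -/
def orderIdeal (c : ℝ≥0) : Ideal GenPoly where
  carrier := {f | ∀ t < c, f.coeff t = 0}
  zero_mem' := by intro t _; simp
  add_mem' := by
    intro f g hf hg t ht
    simp [hf t ht, hg t ht]
  smul_mem' := by
    classical
    intro g f hf t ht
    rw [smul_eq_mul, AddMonoidAlgebra.coeff_mul]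
    refine Finset.sum_eq_zero fun a _ => Finset.sum_eq_zero fun b _ => ?_
    dsimp only
    split_ifs with h
    · rw [hf b (lt_of_le_of_lt (h ▸ le_add_self) ht), mul_zero]
    · rfl

theorem mem_orderIdeal {c : ℝ≥0} {f : GenPoly} :
    f ∈ orderIdeal c ↔ ∀ t < c, f.coeff t = 0 := Iff.rfl

theorem mem_orderIdeal_zero (f : GenPoly) : f ∈ orderIdeal 0 :=
  fun _ ht => absurd ht not_lt_zero

theorem orderIdeal_anti {c d : ℝ≥0} (h : c ≤ d) : orderIdeal d ≤ orderIdeal c :=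
  fun _ hf t ht => hf t (ht.trans_le h)

theorem single_mem_orderIdeal {c a : ℝ≥0} (h : c ≤ a) (r : ℝ) :
    (AddMonoidAlgebra.single a r : GenPoly) ∈ orderIdeal c := by
  intro t ht
  simp [(ht.trans_le h).ne']

/-- The only way to write `c + d` as `a + b` with `c ≤ a` and `d ≤ b` is the trivial one, so
lowest-order terms multiply. -/
theorem coeff_mul_of_mem_orderIdeal {c d : ℝ≥0} {f g : GenPoly}
    (hf : f ∈ orderIdeal c) (hg : g ∈ orderIdeal d) :
    (f * g).coeff (c + d) = f.coeff c * g.coeff d := by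
  classical
  rw [AddMonoidAlgebra.coeff_mul]
  have key : ∀ a b : ℝ≥0, a + b = c + d → (a ≠ c ∨ b ≠ d) → f.coeff a * g.coeff b = 0 := by
    intro a b h hab
    by_cases ha : a < c
    · rw [hf a ha, zero_mul]
    by_cases hb : b < d
    · rw [hg b hb, mul_zero]
    push Not at ha hb
    have h' : (a : ℝ) + b = c + d := by exact_mod_cast h
    have ha' : (c : ℝ) ≤ a := by exact_mod_cast ha
    have hb' : (d : ℝ) ≤ b := by exact_mod_cast hb
    rcases hab with hab | hab
    · exact absurd (NNReal.coe_injective (by linarith)) hab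
    · exact absurd (NNReal.coe_injective (by linarith)) hab
  rw [Finsupp.sum, Finset.sum_eq_single c]
  · rw [Finsupp.sum, Finset.sum_eq_single d]
    · simp
    · intro b _ hb
      split_ifs with h
      · exact key _ _ h (Or.inr hb)
      · rfl
    · intro h
      simp [Finsupp.notMem_support_iff.mp h]
  · intro a _ ha
    refine Finset.sum_eq_zero fun b _ => ?_
    dsimp only
    split_ifs with h
    · exact key _ _ h (Or.inl ha)
    · rfl
  · intro h
    simp [Finsupp.notMem_support_iff.mp h]

theorem mul_mem_orderIdeal_add {c d : ℝ≥0} {f g : GenPoly}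
    (hf : f ∈ orderIdeal c) (hg : g ∈ orderIdeal d) : f * g ∈ orderIdeal (c + d) := by
  classical
  intro t ht
  rw [AddMonoidAlgebra.coeff_mul]
  refine Finset.sum_eq_zero fun a _ => Finset.sum_eq_zero fun b _ => ?_
  dsimp only
  split_ifs with h
  · by_cases ha : a < c
    · rw [hf a ha, zero_mul]
    by_cases hb : b < d
    · rw [hg b hb, mul_zero]
    push Not at ha hb
    exact absurd (h ▸ ht) (add_le_add ha hb).not_gt
  · rfl

/-- The constant coefficient as a ring homomorphism. -/
def constantCoeff : GenPoly →+* ℝ where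
  toFun f := f.coeff 0
  map_one' := by simp
  map_zero' := by simp
  map_add' f g := by simp
  map_mul' f g := by
    simpa using coeff_mul_of_mem_orderIdeal (mem_orderIdeal_zero f) (mem_orderIdeal_zero g)

theorem constantCoeff_apply (f : GenPoly) : constantCoeff f = f.coeff 0 := rfl

theorem coeff_mul_of_mem_right {d : ℝ≥0} {f g : GenPoly} (hg : g ∈ orderIdeal d) :
    (f * g).coeff d = constantCoeff f * g.coeff d := by
  simpa [constantCoeff_apply] using coeff_mul_of_mem_orderIdeal (mem_orderIdeal_zero f) hg

/-- At the least exponent of `f` the product `u * f` has the coefficient of `f` times the nonzero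
constant term of `u`; multiplying by `u` therefore cannot raise the order. -/
theorem mem_orderIdeal_of_mul_mem {c : ℝ≥0} {u f : GenPoly} (hu : constantCoeff u ≠ 0)
    (h : u * f ∈ orderIdeal c) : f ∈ orderIdeal c := by
  by_contra hf
  have hne : (f.coeff.support.filter (· < c)).Nonempty := by
    simp only [mem_orderIdeal, not_forall] at hf
    obtain ⟨t, ht, hft⟩ := hf
    exact ⟨t, by simp [hft, ht]⟩
  obtain ⟨t, ht, hmin⟩ := Finset.exists_min_image _ id hne
  simp only [Finset.mem_filter, Finsupp.mem_support_iff, id_eq] at ht hmin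
  have hft : f ∈ orderIdeal t := by
    intro s hs
    by_contra hne
    exact absurd (hmin s ⟨hne, hs.trans ht.2⟩) hs.not_ge
  have := coeff_mul_of_mem_right (f := u) hft
  rw [h t ht.2] at this
  exact mul_ne_zero hu ht.1 this.symm

/-! ### The similarity matrix over generalized polynomials and homogeneous spaces -/

section Space

variable (X : Type u) [MetricSpace X]

/-- The matrix `(q ^ d(x, y))` with entries in the ring of generalized polynomials. -/
def polyMatrix : Matrix X X GenPoly :=
  Matrix.of fun x y => AddMonoidAlgebra.single (nndist x y) 1

variable {X} [Fintype X]

open scoped Classical in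
theorem constantCoeff_polyMatrix : constantCoeff.mapMatrix (polyMatrix X) = 1 := by
  ext x y
  simp only [RingHom.mapMatrix_apply, Matrix.map_apply, polyMatrix, Matrix.of_apply,
    constantCoeff_apply, AddMonoidAlgebra.coeff_single, Finsupp.single_apply, nndist_eq_zero,
    Matrix.one_apply]

open scoped Classical in
theorem constantCoeff_det : constantCoeff (polyMatrix X).det = 1 := by
  rw [RingHom.map_det, constantCoeff_polyMatrix, Matrix.det_one]

open scoped Classical in
theorem constantCoeff_adjugate (x y : X) :
    constantCoeff ((polyMatrix X).adjugate x y) = (1 : Matrix X X ℝ) x y := by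
  have := RingHom.map_adjugate constantCoeff (polyMatrix X)
  rw [constantCoeff_polyMatrix, Matrix.adjugate_one] at this
  rw [← this]
  rfl

omit [Fintype X] in
open scoped Classical in
theorem polyMatrix_sub_one_mem {d : ℝ≥0} (hd : ∀ x y : X, x ≠ y → d ≤ nndist x y) (x y : X) :
    polyMatrix X x y - (1 : Matrix X X GenPoly) x y ∈ orderIdeal d := by
  by_cases h : x = y
  · subst h
    simp [polyMatrix, AddMonoidAlgebra.one_def]
  · simpa [polyMatrix, Matrix.one_apply, h] using single_mem_orderIdeal (hd x y h) 1

open scoped Classical in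
theorem quotient_mk_polyMatrix {d : ℝ≥0} (hd : ∀ x y : X, x ≠ y → d ≤ nndist x y) :
    (Ideal.Quotient.mk (orderIdeal d)).mapMatrix (polyMatrix X) = 1 := by
  ext x y
  have := Ideal.Quotient.eq.mpr (polyMatrix_sub_one_mem hd x y)
  rw [RingHom.mapMatrix_apply, Matrix.map_apply, this, Matrix.one_apply, Matrix.one_apply]
  split_ifs <;> simp

open scoped Classical in
theorem det_sub_one_mem {d : ℝ≥0} (hd : ∀ x y : X, x ≠ y → d ≤ nndist x y) :
    (polyMatrix X).det - 1 ∈ orderIdeal d := by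
  rw [← Ideal.Quotient.eq, RingHom.map_det, quotient_mk_polyMatrix hd, Matrix.det_one, map_one]

open scoped Classical in
theorem adjugate_sub_one_mem {d : ℝ≥0} (hd : ∀ x y : X, x ≠ y → d ≤ nndist x y) (x y : X) :
    (polyMatrix X).adjugate x y - (1 : Matrix X X GenPoly) x y ∈ orderIdeal d := by
  have := RingHom.map_adjugate (Ideal.Quotient.mk (orderIdeal d)) (polyMatrix X)
  rw [quotient_mk_polyMatrix hd, Matrix.adjugate_one] at this
  have h := congrFun (congrFun this x) y
  rw [RingHom.mapMatrix_apply, Matrix.map_apply] at h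
  rw [← Ideal.Quotient.eq, h, Matrix.one_apply, Matrix.one_apply]
  split_ifs <;> simp

open scoped Classical in
theorem polyMatrix_adjugate_symm (x y : X) :
    (polyMatrix X).adjugate x y = (polyMatrix X).adjugate y x := by
  have h : (polyMatrix X).transpose = polyMatrix X := by
    ext x y
    simp [polyMatrix, nndist_comm]
  have := Matrix.adjugate_transpose (polyMatrix X)
  rw [h] at this
  exact congrFun (congrFun this y) x

open scoped Classical in
theorem formalMagnitude_mul_det :
    formalMagnitude X * algebraMap GenPoly GenRat (polyMatrix X).det =
      algebraMap GenPoly GenRat (∑ x : X, ∑ y : X, (polyMatrix X).adjugate x y) := by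
  have hz : zMatrix X = (algebraMap GenPoly GenRat).mapMatrix (polyMatrix X) := rfl
  have hdet : (zMatrix X).det = algebraMap GenPoly GenRat (polyMatrix X).det := by
    rw [hz, RingHom.map_det]
  have hne : algebraMap GenPoly GenRat (polyMatrix X).det ≠ 0 := by
    rw [Ne, FaithfulSMul.algebraMap_eq_zero_iff]
    intro h
    have := constantCoeff_det (X := X)
    rw [h, map_zero] at this
    exact zero_ne_one this
  have hadj : ∀ x y, (zMatrix X).adjugate x y =
      algebraMap GenPoly GenRat ((polyMatrix X).adjugate x y) := by
    intro x y
    rw [hz, ← RingHom.map_adjugate]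
    rfl
  simp only [formalMagnitude, Matrix.inv_def, Matrix.smul_apply, hadj, smul_eq_mul, hdet,
    Ring.inverse_eq_inv', ← Finset.mul_sum, map_sum]
  field_simp

/-- The row sum `∑ y, q ^ d(x, y)`. -/
def rowPoly (x : X) : GenPoly := ∑ y : X, AddMonoidAlgebra.single (nndist x y) 1

open scoped Classical in
theorem sum_adjugate_mul_rowPoly (x : X) :
    ∑ y : X, (polyMatrix X).adjugate x y * rowPoly y = (polyMatrix X).det := by
  have h : ∀ y : X, rowPoly y = (polyMatrix X).mulVec 1 y := by
    intro y
    simp [rowPoly, polyMatrix, Matrix.mulVec, dotProduct]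
  have := congrFun (congrArg (fun M : Matrix X X GenPoly => M.mulVec 1)
    (Matrix.adjugate_mul (polyMatrix X))) x
  simp only [← Matrix.mulVec_mulVec] at this
  rw [Matrix.smul_mulVec, Matrix.one_mulVec] at this
  simp only [h]
  simpa [Matrix.mulVec, dotProduct] using this

/-- The all-ones vector is an eigenvector of the matrix with eigenvalue `r`, so each row sum of the
adjugate times `r` is the determinant. -/
theorem formalMagnitude_mul_of_rowPoly_eq {r : GenPoly} (h : ∀ x : X, rowPoly x = r) :
    formalMagnitude X * algebraMap GenPoly GenRat r = Fintype.card X := by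
  classical
  have hne : algebraMap GenPoly GenRat (polyMatrix X).det ≠ 0 := by
    rw [Ne, FaithfulSMul.algebraMap_eq_zero_iff]
    intro h
    have := constantCoeff_det (X := X)
    rw [h, map_zero] at this
    exact zero_ne_one this
  have h1 : (∑ x : X, ∑ y : X, (polyMatrix X).adjugate x y) * r =
      Fintype.card X * (polyMatrix X).det := by
    rw [Finset.sum_mul]
    have : ∀ x : X, (∑ y : X, (polyMatrix X).adjugate x y) * r = (polyMatrix X).det := by
      intro x
      rw [← sum_adjugate_mul_rowPoly x, Finset.sum_mul]
      simp [h]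
    rw [Finset.sum_congr rfl fun x _ => this x]
    simp
  have h2 := formalMagnitude_mul_det (X := X)
  have h3 := congrArg (algebraMap GenPoly GenRat) h1
  rw [map_mul, ← h2, map_mul, map_natCast] at h3
  apply mul_right_cancel₀ hne
  rw [← h3]
  ring

end Space

/-! ### The row defects and the quadratic identity -/

section Defect

variable {X : Type u} [MetricSpace X] [Fintype X]

variable (X) in
/-- The sum of all entries of the matrix `(q ^ d(x, y))`. -/
def totalPoly : GenPoly := ∑ x : X, rowPoly x

/-- The deviation of a row sum from the mean row sum, scaled by the number of points. -/
def rowDefect (x : X) : GenPoly := Fintype.card X * rowPoly x - totalPoly X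

theorem sum_rowDefect : ∑ x : X, rowDefect x = 0 := by
  simp [rowDefect, Finset.sum_sub_distrib, ← Finset.mul_sum, totalPoly]

open scoped Classical in
variable (X) in
/-- The value of the quadratic form of the adjugate matrix at the row defects. -/
def defectForm : GenPoly :=
  ∑ x : X, ∑ y : X, rowDefect x * (polyMatrix X).adjugate x y * rowDefect y

-- Applying the adjugate to `n • Z 1 = T • 1 + δ` gives one equation per row. Summing the rows gives
-- `S T + τ = n ^ 2 D`; pairing them with `δ`, which sums to zero, gives `τ T + Q = 0`. Eliminating
-- `S` and `τ` leaves the identity. Symmetry of the adjugate makes the two occurrences of `τ` the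
-- same.
open scoped Classical in
theorem totalPoly_sub_eq {r : GenPoly}
    (h : (∑ x : X, ∑ y : X, (polyMatrix X).adjugate x y) * r =
      Fintype.card X * (polyMatrix X).det) :
    (Fintype.card X * (polyMatrix X).det * totalPoly X) *
      (totalPoly X - Fintype.card X * r) = r * defectForm X := by
  set n : GenPoly := (Fintype.card X : GenPoly) with hn
  set D := (polyMatrix X).det with hD
  set T := totalPoly X with hT
  set S := ∑ x : X, ∑ y : X, (polyMatrix X).adjugate x y with hS
  set τ := ∑ x : X, ∑ y : X, (polyMatrix X).adjugate x y * rowDefect y with hτ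
  have hrow : ∀ x : X, (∑ y : X, (polyMatrix X).adjugate x y) * T +
      ∑ y : X, (polyMatrix X).adjugate x y * rowDefect y = n * D := by
    intro x
    rw [hD, ← sum_adjugate_mul_rowPoly x, Finset.sum_mul, ← Finset.sum_add_distrib,
      Finset.mul_sum]
    refine Finset.sum_congr rfl fun y _ => ?_
    rw [rowDefect]
    ring
  have h1 : S * T + τ = n * (n * D) := by
    rw [hS, hτ, Finset.sum_mul, ← Finset.sum_add_distrib, Finset.sum_congr rfl fun x _ => hrow x]
    simp [hn]
  have h2 : τ * T + defectForm X = 0 := by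
    have hτ' : τ = ∑ x : X, rowDefect x * ∑ y : X, (polyMatrix X).adjugate x y := by
      rw [hτ, Finset.sum_comm]
      refine Finset.sum_congr rfl fun y _ => ?_
      rw [Finset.mul_sum]
      refine Finset.sum_congr rfl fun x _ => ?_
      rw [polyMatrix_adjugate_symm x y, mul_comm]
    have hQ : defectForm X =
        ∑ x : X, rowDefect x * ∑ y : X, (polyMatrix X).adjugate x y * rowDefect y := by
      simp only [defectForm, Finset.mul_sum, mul_assoc]
    rw [hτ', hQ, Finset.sum_mul, ← Finset.sum_add_distrib]
    have : ∀ x : X, (rowDefect x * ∑ y : X, (polyMatrix X).adjugate x y) * T +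
        rowDefect x * ∑ y : X, (polyMatrix X).adjugate x y * rowDefect y =
        rowDefect x * (n * D) := by
      intro x
      rw [← hrow x]
      ring
    rw [Finset.sum_congr rfl fun x _ => this x, ← Finset.sum_mul, sum_rowDefect, zero_mul]
  linear_combination (T * r) * h1 - r * h2 - T ^ 2 * h

theorem constantCoeff_rowPoly (x : X) : constantCoeff (rowPoly x) = 1 := by
  classical
  rw [rowPoly, map_sum, Finset.sum_eq_single x]
  · simp [constantCoeff_apply]
  · intro y _ hy
    simp [constantCoeff_apply, hy.symm]
  · simp

theorem constantCoeff_totalPoly : constantCoeff (totalPoly X) = Fintype.card X := by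
  simp [totalPoly, constantCoeff_rowPoly]

open scoped Classical in
theorem adjugate_identity_of_formalMagnitude_eq {A : Type v} [MetricSpace A] [Fintype A]
    {r : GenPoly} (hA : ∀ a : A, rowPoly a = r) (h : formalMagnitude X = formalMagnitude A) :
    (∑ x : X, ∑ y : X, (polyMatrix X).adjugate x y) * r =
      Fintype.card A * (polyMatrix X).det := by
  apply FaithfulSMul.algebraMap_injective GenPoly GenRat
  have h1 := formalMagnitude_mul_of_rowPoly_eq hA
  rw [map_mul, ← formalMagnitude_mul_det, h, map_mul, map_natCast, ← h1]
  ring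

theorem card_eq_of_formalMagnitude_eq {A : Type v} [MetricSpace A] [Fintype A] [Nonempty A]
    {r : GenPoly} (hA : ∀ a : A, rowPoly a = r) (h : formalMagnitude X = formalMagnitude A) :
    Fintype.card X = Fintype.card A := by
  classical
  have := congrArg constantCoeff (adjugate_identity_of_formalMagnitude_eq hA h)
  obtain ⟨a⟩ := ‹Nonempty A›
  rw [map_mul, map_mul, ← hA a, constantCoeff_rowPoly, constantCoeff_det, map_sum] at this
  simp only [map_sum, constantCoeff_adjugate, map_natCast, mul_one] at this
  simpa [Matrix.one_apply] using this

theorem mem_orderIdeal_sum {ι : Type*} {s : Finset ι} {f : ι → GenPoly} {c : ℝ≥0}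
    (h : ∀ i ∈ s, f i ∈ orderIdeal c) : ∑ i ∈ s, f i ∈ orderIdeal c :=
  Ideal.sum_mem _ h

theorem defectForm_mem {e : ℝ≥0} (he : ∀ x : X, rowDefect x ∈ orderIdeal e) :
    defectForm X ∈ orderIdeal (e + e) := by
  classical
  refine mem_orderIdeal_sum fun x _ => mem_orderIdeal_sum fun y _ => ?_
  have h := mul_mem_orderIdeal_add (Ideal.mul_mem_right ((polyMatrix X).adjugate x y) _ (he x))
    (he y)
  exact h

/-- The constant terms of the adjugate form the identity matrix, so only diagonal terms survive in
lowest order. Being a sum of real squares, this coefficient is positive unless all defects vanish at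
`e`; this gives `T - n r` a definite sign. -/
theorem coeff_defectForm {e : ℝ≥0} (he : ∀ x : X, rowDefect x ∈ orderIdeal e) :
    (defectForm X).coeff (e + e) = ∑ x : X, (rowDefect x).coeff e ^ 2 := by
  classical
  simp only [defectForm, AddMonoidAlgebra.coeff_sum, Finsupp.finsetSum_apply]
  refine Finset.sum_congr rfl fun x _ => ?_
  rw [Finset.sum_eq_single x]
  · rw [mul_comm (rowDefect x), mul_assoc,
      coeff_mul_of_mem_right (mul_mem_orderIdeal_add (he x) (he x)),
      coeff_mul_of_mem_orderIdeal (he x) (he x), constantCoeff_adjugate]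
    simp [sq]
  · intro y _ hy
    rw [mul_comm (rowDefect x), mul_assoc,
      coeff_mul_of_mem_right (mul_mem_orderIdeal_add (he x) (he y)), constantCoeff_adjugate,
      Matrix.one_apply_ne hy.symm, zero_mul]
  · simp

open scoped Classical in
theorem constantCoeff_prefactor :
    constantCoeff (Fintype.card X * (polyMatrix X).det * totalPoly X) =
      (Fintype.card X : ℝ) ^ 2 := by
  rw [map_mul, map_mul, constantCoeff_det, constantCoeff_totalPoly, map_natCast]
  ring

open scoped Classical in
theorem totalPoly_sub_mem [Nonempty X] {r : GenPoly} {e : ℝ≥0}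
    (h : (∑ x : X, ∑ y : X, (polyMatrix X).adjugate x y) * r =
      Fintype.card X * (polyMatrix X).det)
    (he : ∀ x : X, rowDefect x ∈ orderIdeal e) :
    totalPoly X - Fintype.card X * r ∈ orderIdeal (e + e) := by
  refine mem_orderIdeal_of_mul_mem
    (u := Fintype.card X * (polyMatrix X).det * totalPoly X) ?_ ?_
  · rw [constantCoeff_prefactor]
    have := Fintype.card_pos (α := X)
    positivity
  · rw [totalPoly_sub_eq h]
    exact Ideal.mul_mem_left _ _ (defectForm_mem he)

open scoped Classical in
theorem coeff_totalPoly_sub [Nonempty X] {r : GenPoly} {e : ℝ≥0} (hr : constantCoeff r = 1)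
    (h : (∑ x : X, ∑ y : X, (polyMatrix X).adjugate x y) * r =
      Fintype.card X * (polyMatrix X).det)
    (he : ∀ x : X, rowDefect x ∈ orderIdeal e) :
    (Fintype.card X : ℝ) ^ 2 * (totalPoly X - Fintype.card X * r).coeff (e + e) =
      ∑ x : X, (rowDefect x).coeff e ^ 2 := by
  have := congrArg (fun f : GenPoly => f.coeff (e + e)) (totalPoly_sub_eq h)
  rwa [coeff_mul_of_mem_right (totalPoly_sub_mem h he), constantCoeff_prefactor,
    coeff_mul_of_mem_right (defectForm_mem he), hr, one_mul, coeff_defectForm he] at this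

theorem rowPoly_sub_one_mem {d : ℝ≥0} (hd : ∀ x y : X, x ≠ y → d ≤ nndist x y) (x : X) :
    rowPoly x - 1 ∈ orderIdeal d := by
  classical
  have h : rowPoly x - 1 = ∑ y ∈ Finset.univ.erase x,
      (AddMonoidAlgebra.single (nndist x y) 1 : GenPoly) := by
    rw [rowPoly, ← Finset.add_sum_erase _ _ (Finset.mem_univ x)]
    simp [AddMonoidAlgebra.one_def]
  rw [h]
  exact mem_orderIdeal_sum fun y hy =>
    single_mem_orderIdeal (hd x y (Finset.ne_of_mem_erase hy).symm) 1

/-- Factor the difference of squares: the difference of `f` and its leading term has order at least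
`e'`, their sum has order at least `e`. -/
theorem sq_sub_single_mem {f : GenPoly} {e e' : ℝ≥0} (he : f ∈ orderIdeal e)
    (he' : ∀ t, e < t → t < e' → f.coeff t = 0) :
    f * f - AddMonoidAlgebra.single (e + e) (f.coeff e ^ 2) ∈ orderIdeal (e + e') := by
  have hw : f - AddMonoidAlgebra.single e (f.coeff e) ∈ orderIdeal e' := by
    intro s hs
    rw [AddMonoidAlgebra.coeff_sub, Finsupp.sub_apply, AddMonoidAlgebra.coeff_single,
      Finsupp.single_apply]
    split_ifs with hse
    · rw [hse, sub_self]
    · rcases lt_or_gt_of_ne hse with hlt | hlt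
      · rw [he' s hlt hs, sub_zero]
      · rw [he s hlt, sub_zero]
  have hs : f + AddMonoidAlgebra.single e (f.coeff e) ∈ orderIdeal e :=
    Ideal.add_mem _ he (single_mem_orderIdeal le_rfl _)
  have h3 : (AddMonoidAlgebra.single (e + e) (f.coeff e ^ 2) : GenPoly) =
      AddMonoidAlgebra.single e (f.coeff e) * AddMonoidAlgebra.single e (f.coeff e) := by
    rw [AddMonoidAlgebra.single_mul_single, sq]
  rw [h3, mul_self_sub_mul_self]
  exact mul_mem_orderIdeal_add hs hw

theorem defectForm_sub_sum_sq_mem {d e : ℝ≥0} (hd : ∀ x y : X, x ≠ y → d ≤ nndist x y)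
    (he : ∀ x : X, rowDefect x ∈ orderIdeal e) :
    defectForm X - ∑ x : X, rowDefect x * rowDefect x ∈ orderIdeal (e + e + d) := by
  classical
  have h : defectForm X - ∑ x : X, rowDefect x * rowDefect x =
      ∑ x : X, ∑ y : X, rowDefect x * rowDefect y *
        ((polyMatrix X).adjugate x y - (1 : Matrix X X GenPoly) x y) := by
    rw [defectForm, ← Finset.sum_sub_distrib]
    refine Finset.sum_congr rfl fun x _ => ?_
    have hy : ∀ y : X, rowDefect x * rowDefect y *
        ((polyMatrix X).adjugate x y - (1 : Matrix X X GenPoly) x y) =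
        rowDefect x * (polyMatrix X).adjugate x y * rowDefect y -
          if x = y then rowDefect x * rowDefect y else 0 := by
      intro y
      rw [Matrix.one_apply, mul_sub, mul_ite, mul_one, mul_zero, mul_right_comm]
    rw [Finset.sum_congr rfl fun y _ => hy y, Finset.sum_sub_distrib, Finset.sum_ite_eq,
      if_pos (Finset.mem_univ x)]
  rw [h]
  exact mem_orderIdeal_sum fun x _ => mem_orderIdeal_sum fun y _ =>
    mul_mem_orderIdeal_add (mul_mem_orderIdeal_add (he x) (he y)) (adjugate_sub_one_mem hd x y)

open scoped Classical in
/-- If the row defects have no exponents strictly between `e` and `e'`, then the exponents of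
the deviation of the total beyond `2e` are at least `min (2e + d) (e + e')`. -/
theorem coeff_totalPoly_sub_eq_zero [Nonempty X] {r : GenPoly} {d e e' : ℝ≥0}
    (hd : ∀ x y : X, x ≠ y → d ≤ nndist x y) (hr : r - 1 ∈ orderIdeal d)
    (h : (∑ x : X, ∑ y : X, (polyMatrix X).adjugate x y) * r =
      Fintype.card X * (polyMatrix X).det)
    (he : ∀ x : X, rowDefect x ∈ orderIdeal e)
    (he' : ∀ (x : X) (t : ℝ≥0), e < t → t < e' → (rowDefect x).coeff t = 0)
    {t : ℝ≥0} (h2 : e + e ≠ t) (htd : t < e + e + d) (hte : t < e + e') :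
    (totalPoly X - Fintype.card X * r).coeff t = 0 := by
  classical
  set n : GenPoly := (Fintype.card X : GenPoly) with hn
  set c : ℝ≥0 := min (e + e + d) (e + e') with hc
  have hcd : c ≤ e + e + d := min_le_left _ _
  have hce : c ≤ e + e' := min_le_right _ _
  have hQ : defectForm X -
      AddMonoidAlgebra.single (e + e) (∑ x : X, (rowDefect x).coeff e ^ 2) ∈ orderIdeal c := by
    have h1 := orderIdeal_anti hcd (defectForm_sub_sum_sq_mem hd he)
    have h2 := mem_orderIdeal_sum (s := Finset.univ) fun (x : X) _ =>
      orderIdeal_anti hce (sq_sub_single_mem (he x) (he' x))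
    rw [Finset.sum_sub_distrib] at h2
    have h3 : (AddMonoidAlgebra.single (e + e) (∑ x : X, (rowDefect x).coeff e ^ 2) : GenPoly)
        = ∑ x : X, AddMonoidAlgebra.single (e + e) ((rowDefect x).coeff e ^ 2) :=
      map_sum (AddMonoidAlgebra.singleAddHom (e + e)) _ _
    rw [h3, ← sub_add_sub_cancel]
    exact Ideal.add_mem _ h1 h2
  -- In `totalPoly_sub_eq` the factor `r` is replaced by `1` and the prefactor by `n * n`; each
  -- replacement errs only from exponent `2e + d` on.
  have hrQ : (r - 1) * defectForm X ∈ orderIdeal c := by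
    refine orderIdeal_anti hcd ?_
    rw [mul_comm]
    exact mul_mem_orderIdeal_add (defectForm_mem he) hr
  have hT : totalPoly X - n ∈ orderIdeal d := by
    have : totalPoly X - n = ∑ x : X, (rowPoly x - 1) := by
      simp [totalPoly, hn]
    rw [this]
    exact mem_orderIdeal_sum fun x _ => rowPoly_sub_one_mem hd x
  have hpre : n * (polyMatrix X).det * totalPoly X - n * n ∈ orderIdeal d := by
    have : n * (polyMatrix X).det * totalPoly X - n * n =
        n * totalPoly X * ((polyMatrix X).det - 1) + n * (totalPoly X - n) := by ring
    rw [this]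
    exact Ideal.add_mem _ (Ideal.mul_mem_left _ _ (det_sub_one_mem hd))
      (Ideal.mul_mem_left _ _ hT)
  have hδ := totalPoly_sub_mem h he
  have hpreδ : (n * (polyMatrix X).det * totalPoly X - n * n) *
      (totalPoly X - n * r) ∈ orderIdeal c := by
    refine orderIdeal_anti hcd ?_
    rw [mul_comm]
    exact mul_mem_orderIdeal_add hδ hpre
  have hfin : n * n * (totalPoly X - n * r) -
      AddMonoidAlgebra.single (e + e) (∑ x : X, (rowDefect x).coeff e ^ 2) ∈ orderIdeal c := by
    have := Ideal.sub_mem _ (Ideal.add_mem _ hQ hrQ) hpreδ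
    convert this using 1
    linear_combination totalPoly_sub_eq h
  have hcoef := hfin t (lt_min htd hte)
  rw [AddMonoidAlgebra.coeff_sub, Finsupp.sub_apply, AddMonoidAlgebra.coeff_single,
    Finsupp.single_eq_of_ne h2.symm, sub_zero] at hcoef
  have hnn : n * n * (totalPoly X - n * r) =
      ((Fintype.card X * Fintype.card X : ℕ)) • (totalPoly X - n * r) := by
    rw [nsmul_eq_mul]
    push_cast
    rfl
  rw [hnn, AddMonoidAlgebra.coeff_smul, Finsupp.smul_apply, smul_eq_zero] at hcoef
  rcases hcoef with h0 | h0
  · have := Fintype.card_pos (α := X)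
    simp_all
  · exact h0

end Defect

/-! ### Counting distances and rigidity of the row sums -/

section Count

variable {X : Type u} [MetricSpace X] [Fintype X]

open scoped Classical in
/-- The number of points at distance `t` from `x`. -/
def distCount (x : X) (t : ℝ≥0) : ℕ := (Finset.univ.filter fun y : X => nndist x y = t).card

theorem coeff_rowPoly (x : X) (t : ℝ≥0) : (rowPoly x).coeff t = distCount x t := by
  classical
  rw [rowPoly, AddMonoidAlgebra.coeff_sum, Finsupp.finsetSum_apply, distCount,
    Finset.card_filter]
  push_cast
  refine Finset.sum_congr rfl fun y _ => ?_
  rw [AddMonoidAlgebra.coeff_single, Finsupp.single_apply]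

theorem coeff_totalPoly (t : ℝ≥0) : (totalPoly X).coeff t = ∑ x : X, (distCount x t : ℝ) := by
  rw [totalPoly, AddMonoidAlgebra.coeff_sum, Finsupp.finsetSum_apply]
  exact Finset.sum_congr rfl fun x _ => coeff_rowPoly x t

theorem natCast_mul_coeff (n : ℕ) (f : GenPoly) (t : ℝ≥0) :
    ((n : GenPoly) * f).coeff t = n * f.coeff t := by
  rw [← nsmul_eq_mul, AddMonoidAlgebra.coeff_smul, Finsupp.smul_apply, nsmul_eq_mul]

theorem coeff_rowDefect (x : X) (t : ℝ≥0) :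
    (rowDefect x).coeff t = Fintype.card X * distCount x t - (totalPoly X).coeff t := by
  rw [rowDefect, AddMonoidAlgebra.coeff_sub, Finsupp.sub_apply, natCast_mul_coeff, coeff_rowPoly]

theorem coeff_totalPoly_nonneg (t : ℝ≥0) : 0 ≤ (totalPoly X).coeff t := by
  rw [coeff_totalPoly]
  positivity

theorem distCount_eq_zero_of_total {t : ℝ≥0} (h : (totalPoly X).coeff t = 0) (x : X) :
    distCount x t = 0 := by
  rw [coeff_totalPoly, Finset.sum_eq_zero_iff_of_nonneg fun _ _ => Nat.cast_nonneg _] at h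
  exact_mod_cast h x (Finset.mem_univ x)

theorem distCount_pos {x : X} {t : ℝ≥0} : 0 < distCount x t ↔ ∃ y : X, nndist x y = t := by
  simp [distCount, Finset.card_pos, Finset.Nonempty]

open scoped Classical in
theorem sum_distCount (x : X) (s : Finset ℝ≥0) :
    ∑ t ∈ s, distCount x t = (Finset.univ.filter fun y : X => nndist x y ∈ s).card := by
  rw [Finset.card_eq_sum_card_fiberwise (f := fun y => nndist x y) (t := s)
    (fun y hy => by simpa using hy)]
  refine Finset.sum_congr rfl fun t ht => ?_
  rw [distCount, Finset.filter_filter]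
  congr 1
  ext y
  simp only [Finset.mem_filter, Finset.mem_univ, true_and]
  constructor
  · rintro rfl
    exact ⟨ht, rfl⟩
  · exact fun h => h.2

theorem sum_coeff_totalPoly_le (s : Finset ℝ≥0) :
    ∑ t ∈ s, (totalPoly X).coeff t ≤ (Fintype.card X : ℝ) * Fintype.card X := by
  classical
  simp only [coeff_totalPoly]
  rw [Finset.sum_comm]
  have : ∀ x : X, ∑ t ∈ s, (distCount x t : ℝ) ≤ Fintype.card X := by
    intro x
    have h := sum_distCount x s
    have h2 : (Finset.univ.filter fun y : X => nndist x y ∈ s).card ≤ Fintype.card X :=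
      Finset.card_le_univ _
    rw [← h] at h2
    exact_mod_cast h2
  refine (Finset.sum_le_sum fun x _ => this x).trans ?_
  simp

theorem exists_least_defect (h : ¬ ∀ x : X, rowDefect x = 0) :
    ∃ e : ℝ≥0, (∀ x : X, rowDefect x ∈ orderIdeal e) ∧ ∃ x : X, (rowDefect x).coeff e ≠ 0 := by
  classical
  push Not at h
  obtain ⟨x₀, hx₀⟩ := h
  have hne : (Finset.univ.biUnion fun x : X => (rowDefect x).coeff.support).Nonempty := by
    have h0 : (rowDefect x₀).coeff ≠ 0 := by simpa using hx₀
    obtain ⟨t, ht⟩ := Finsupp.support_nonempty_iff.mpr h0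
    exact ⟨t, Finset.mem_biUnion.mpr ⟨x₀, Finset.mem_univ _, ht⟩⟩
  obtain ⟨e, he, hmin⟩ := Finset.exists_min_image _ id hne
  simp only [Finset.mem_biUnion, Finset.mem_univ, true_and, Finsupp.mem_support_iff, id_eq,
    forall_exists_index] at he hmin
  refine ⟨e, fun x t ht => ?_, he⟩
  by_contra hne
  exact absurd (hmin t x hne) ht.not_ge

theorem rowPoly_eq_of_rowDefect_eq_zero [Nonempty X] {r : GenPoly}
    (h : open scoped Classical in (∑ x : X, ∑ y : X, (polyMatrix X).adjugate x y) * r =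
      Fintype.card X * (polyMatrix X).det)
    (h0 : ∀ x : X, rowDefect x = 0) (x : X) : rowPoly x = r := by
  classical
  have hcard : (Fintype.card X : ℝ) ≠ 0 := by
    exact_mod_cast (Fintype.card_pos (α := X)).ne'
  have key := totalPoly_sub_eq h
  have hQ : defectForm X = 0 := by
    simp [defectForm, h0]
  rw [hQ, mul_zero, mul_eq_zero] at key
  have hT : totalPoly X - Fintype.card X * r = 0 := by
    refine key.resolve_left fun hz => ?_
    have := constantCoeff_prefactor (X := X)
    rw [hz, map_zero] at this
    exact pow_ne_zero 2 hcard this.symm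
  have hx := h0 x
  rw [rowDefect, sub_eq_zero] at hx
  rw [sub_eq_zero, ← hx] at hT
  have hn : (Fintype.card X : GenPoly) ≠ 0 := by
    intro hz
    have := congrArg constantCoeff hz
    rw [map_natCast, map_zero] at this
    exact hcard this
  exact mul_left_cancel₀ hn hT

/-- Let `A` be a homogeneous space whose nonzero distances are `1` or in `[s, 1 + s)`, where
`1 < s ≤ 2`. A space with the same formal magnitude has the same row sums as `A`. -/
theorem rowPoly_eq_of_formalMagnitude_eq {A : Type v} [MetricSpace A] [Fintype A] [Nonempty A]
    {r : GenPoly} (hA : ∀ a : A, rowPoly a = r) {s : ℝ≥0} (hs1 : 1 < s) (hs2 : s ≤ 2)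
    (hdist : ∀ a b : A, a ≠ b → nndist a b = 1 ∨ s ≤ nndist a b ∧ nndist a b < 1 + s)
    (h : formalMagnitude X = formalMagnitude A) (x : X) : rowPoly x = r := by
  classical
  have hcard := card_eq_of_formalMagnitude_eq hA h
  have hid := adjugate_identity_of_formalMagnitude_eq hA h
  rw [← hcard] at hid
  obtain ⟨a₀⟩ := ‹Nonempty A›
  have : Nonempty X := ⟨x⟩
  have hn : (0 : ℝ) < Fintype.card X := by exact_mod_cast Fintype.card_pos (α := X)
  have hr0 : constantCoeff r = 1 := by rw [← hA a₀, constantCoeff_rowPoly]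
  have hr : ∀ t, r.coeff t ≠ 0 → t = 0 ∨ t = 1 ∨ s ≤ t ∧ t < 1 + s := by
    intro t ht
    rw [← hA a₀, coeff_rowPoly, Nat.cast_ne_zero, ← Nat.pos_iff_ne_zero, distCount_pos] at ht
    obtain ⟨b, rfl⟩ := ht
    by_cases hb : a₀ = b
    · left
      simp [hb]
    · exact Or.inr (hdist a₀ b hb)
  by_cases h0 : ∀ x : X, rowDefect x = 0
  · exact rowPoly_eq_of_rowDefect_eq_zero hid h0 x
  exfalso
  obtain ⟨e, he, x₁, hx₁⟩ := exists_least_defect h0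
  have hsub : ∀ t, (totalPoly X - Fintype.card X * r).coeff t =
      (totalPoly X).coeff t - Fintype.card X * r.coeff t := by
    intro t
    rw [AddMonoidAlgebra.coeff_sub, Finsupp.sub_apply, natCast_mul_coeff]
  have hlow : ∀ t < e + e, (totalPoly X).coeff t = Fintype.card X * r.coeff t := by
    intro t ht
    have := totalPoly_sub_mem hid he t ht
    rwa [hsub, sub_eq_zero] at this
  have hlead : Fintype.card X * r.coeff (e + e) < (totalPoly X).coeff (e + e) := by
    have h1 := coeff_totalPoly_sub hr0 hid he
    have h2 : 0 < ∑ x : X, (rowDefect x).coeff e ^ 2 :=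
      Finset.sum_pos' (fun _ _ => sq_nonneg _) ⟨x₁, Finset.mem_univ _, by positivity⟩
    rw [← h1, hsub] at h2
    have := pos_of_mul_pos_right h2 (by positivity)
    linarith
  have he0 : 0 < e := by
    rw [pos_iff_ne_zero]
    rintro rfl
    apply hx₁
    rw [← constantCoeff_apply, rowDefect, map_sub, map_mul, constantCoeff_rowPoly,
      constantCoeff_totalPoly, map_natCast, mul_one, sub_self]
  -- Below `2e` the totals agree, so a distance that is absent from `A` is absent from `X`. Since `e
  -- < 2e`, it follows that `e` itself is a distance of `A`.
  have hzero : ∀ t < e + e, r.coeff t = 0 → ∀ x : X, (rowDefect x).coeff t = 0 := by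
    intro t ht hrt x
    have hT := hlow t ht
    rw [hrt, mul_zero] at hT
    rw [coeff_rowDefect, hT, distCount_eq_zero_of_total hT x]
    simp
  have hle : e < e + e := lt_add_of_pos_right e he0
  have hre : r.coeff e ≠ 0 := fun hre => hx₁ (hzero e hle hre x₁)
  have hbound : ∀ t, r.coeff t ≠ 0 → Fintype.card X * r.coeff t ≤ (totalPoly X).coeff t := by
    intro t ht
    rcases lt_trichotomy t (e + e) with hlt | rfl | hlt
    · exact (hlow t hlt).ge
    · exact hlead.le
    -- The case beyond `2e`: from `e ≥ s` would follow `t > 2s > 1 + s`, so `e = 1`. As `A` has no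
    -- distances in `(1, s)`, neither have the defects, and the second-order estimate applies with
    -- `d = 1` and `e' = s`.
    have hts : t < 1 + s := by
      rcases hr t ht with rfl | rfl | h3
      · exact absurd hlt not_lt_zero
      · exact lt_add_of_pos_right 1 (zero_lt_one.trans hs1)
      · exact h3.2
    have he1 : e = 1 := by
      rcases hr e hre with h3 | h3 | h3
      · exact absurd h3 he0.ne'
      · exact h3
      · have : 1 + s < e + e :=
          (add_lt_add_of_lt_of_le hs1 le_rfl).trans_le (add_le_add h3.1 h3.1)
        exact absurd (this.trans hlt) hts.not_gt
    subst he1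
    have hd : ∀ x y : X, x ≠ y → 1 ≤ nndist x y := by
      intro x y hxy
      by_contra hlt1
      push Not at hlt1
      have h4 : r.coeff (nndist x y) ≠ 0 := by
        intro h5
        have hT := hlow _ (hlt1.trans hle)
        rw [h5, mul_zero] at hT
        have h6 := distCount_eq_zero_of_total hT x
        exact (distCount_pos.mpr ⟨y, rfl⟩).ne' h6
      rcases hr _ h4 with h5 | h5 | h5
      · exact hxy (nndist_eq_zero.mp h5)
      · exact hlt1.ne h5
      · exact absurd (hs1.trans_le h5.1) hlt1.not_gt
    have hr1 : r - 1 ∈ orderIdeal 1 := by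
      rw [← hA a₀]
      refine rowPoly_sub_one_mem (fun a b hab => ?_) a₀
      rcases hdist a b hab with h5 | h5
      · exact h5.ge
      · exact hs1.le.trans h5.1
    have hgap : ∀ (x : X) (t : ℝ≥0), 1 < t → t < s → (rowDefect x).coeff t = 0 := by
      intro x t ht1 ht2
      refine hzero t (ht2.trans_le (hs2.trans (by norm_num))) ?_ x
      by_contra h5
      rcases hr t h5 with h6 | h6 | h6
      · exact absurd ht1 (by simp [h6])
      · exact ht1.ne' h6
      · exact absurd ht2 h6.1.not_gt
    have h7 := coeff_totalPoly_sub_eq_zero hd hr1 hid he hgap hlt.ne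
      (hts.trans_le (by rw [add_comm]; gcongr; exact hs2.trans (by norm_num))) hts
    rw [hsub] at h7
    linarith
  -- The set contains all distances of `A`, so `r` has its full mass there, and also `2e`, which
  -- need not be a distance of `A` but is where the inequality is strict.
  set S : Finset ℝ≥0 := insert (e + e) (Finset.univ.image fun b : A => nndist a₀ b) with hS
  have h1 : ∑ t ∈ S, (Fintype.card X : ℝ) * r.coeff t < ∑ t ∈ S, (totalPoly X).coeff t := by
    refine Finset.sum_lt_sum (fun t _ => ?_) ⟨e + e, Finset.mem_insert_self _ _, hlead⟩
    by_cases ht : r.coeff t = 0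
    · rw [ht, mul_zero]
      exact coeff_totalPoly_nonneg t
    · exact hbound t ht
  have h2 : ∑ t ∈ S, r.coeff t = Fintype.card X := by
    have h3 := sum_distCount a₀ S
    rw [Finset.filter_true_of_mem (fun b _ => by simp [hS]), Finset.card_univ, ← hcard] at h3
    rw [← h3]
    push_cast
    refine Finset.sum_congr rfl fun t _ => ?_
    rw [← hA a₀, coeff_rowPoly]
  rw [← Finset.mul_sum, h2] at h1
  exact absurd (sum_coeff_totalPoly_le S) h1.not_ge

end Count

/-! ### Polygons and cycles modelled on `ZMod n` -/

section Models

/-- The distance from `0` to `x` around the cycle `ZMod n`. -/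
def cyclicNorm {n : ℕ} (x : ZMod n) : ℕ := x.valMinAbs.natAbs

theorem cyclicNorm_neg {n : ℕ} (x : ZMod n) : cyclicNorm (-x) = cyclicNorm x :=
  ZMod.natAbs_valMinAbs_neg x

theorem cyclicNorm_add_le {n : ℕ} (x y : ZMod n) :
    cyclicNorm (x + y) ≤ cyclicNorm x + cyclicNorm y :=
  (ZMod.natAbs_valMinAbs_add_le x y).trans (Int.natAbs_add_le _ _)

theorem cyclicNorm_eq_zero {n : ℕ} {x : ZMod n} : cyclicNorm x = 0 ↔ x = 0 := by
  rw [cyclicNorm, Int.natAbs_eq_zero, ZMod.valMinAbs_eq_zero]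

theorem cyclicNorm_le {n : ℕ} [NeZero n] (x : ZMod n) : cyclicNorm x ≤ n / 2 :=
  ZMod.natAbs_valMinAbs_le x

theorem cyclicNorm_one_le {n : ℕ} : cyclicNorm (1 : ZMod n) ≤ 1 := by
  rcases n with _ | _ | _ | n
  · decide
  · decide
  · decide
  · have := ZMod.valMinAbs_natCast_of_le_half (n := n + 3) (a := 1) (by omega)
    rw [Nat.cast_one] at this
    rw [cyclicNorm, this]
    rfl

/-- The ratio of the length of the `k`-th diagonal of a regular `n`-gon to its side. -/
def chord (n k : ℕ) : ℝ := Real.sin (Real.pi * k / n) / Real.sin (Real.pi / n)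

theorem sin_pi_div_pos {n : ℕ} (hn : 2 ≤ n) : 0 < Real.sin (Real.pi / n) := by
  have hn' : (2 : ℝ) ≤ n := by exact_mod_cast hn
  apply Real.sin_pos_of_pos_of_lt_pi
  · have := Real.pi_pos
    positivity
  · rw [div_lt_iff₀ (by linarith)]
    nlinarith [Real.pi_pos]

/-- Points of the unit circle at angles `x` and `y` are `2 |sin ((x - y) / 2)|` apart; the `2`
cancels against the circumradius. -/
theorem dist_regularPolygonVertex {n : ℕ} (hn : 2 ≤ n) (i j : Fin n) :
    dist (regularPolygonVertex n i) (regularPolygonVertex n j) =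
      |Real.sin (Real.pi * ((i : ℕ) - (j : ℕ) : ℝ) / n)| / Real.sin (Real.pi / n) := by
  have hs := sin_pi_div_pos hn
  rw [EuclideanSpace.dist_eq, Fin.sum_univ_two, Real.dist_eq, Real.dist_eq, sq_abs, sq_abs]
  have h : ∀ x y z s : ℝ, x - y = 2 * z → s ≠ 0 →
      (Real.cos x / (2 * s) - Real.cos y / (2 * s)) ^ 2 +
        (Real.sin x / (2 * s) - Real.sin y / (2 * s)) ^ 2 = (|Real.sin z| / s) ^ 2 := by
    intro x y z s hxy hs
    have h1 : Real.cos (2 * z) = Real.cos x * Real.cos y + Real.sin x * Real.sin y := by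
      rw [← hxy, Real.cos_sub]
    rw [Real.cos_two_mul'] at h1
    have h2 := Real.sin_sq_add_cos_sq x
    have h3 := Real.sin_sq_add_cos_sq y
    have h4 := Real.sin_sq_add_cos_sq z
    rw [div_pow, sq_abs]
    field_simp
    linear_combination h2 + h3 + 2 * h1 - 2 * h4
  simp only [regularPolygonVertex, PiLp.toLp_apply, Matrix.cons_val_zero, Matrix.cons_val_one]
  rw [h _ _ (Real.pi * ((i : ℕ) - (j : ℕ) : ℝ) / n) _ (by ring) hs.ne', Real.sqrt_sq]
  positivity

theorem abs_sin_pi_mul_div_eq {n : ℕ} [NeZero n] (k : ℤ) :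
    |Real.sin (Real.pi * k / n)| = Real.sin (Real.pi * cyclicNorm (k : ZMod n) / n) := by
  have hn : (n : ℝ) ≠ 0 := by exact_mod_cast NeZero.ne n
  have hn0 : (0 : ℝ) < n := by exact_mod_cast Nat.pos_of_neZero n
  have hc : (((k : ZMod n).valMinAbs : ℤ) : ZMod n) = (k : ZMod n) := ZMod.coe_valMinAbs _
  rw [ZMod.intCast_eq_intCast_iff_dvd_sub] at hc
  obtain ⟨t, ht⟩ := hc
  have hk : (k : ℝ) = ((k : ZMod n).valMinAbs : ℤ) + n * t := by
    have : k = (k : ZMod n).valMinAbs + n * t := by linarith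
    exact_mod_cast this
  have h1 : |Real.sin (Real.pi * k / n)| =
      |Real.sin (Real.pi * ((k : ZMod n).valMinAbs : ℤ) / n)| := by
    have : Real.pi * k / n = Real.pi * ((k : ZMod n).valMinAbs : ℤ) / n + t * Real.pi := by
      rw [hk]
      field_simp
    rw [this, Real.sin_add_int_mul_pi, abs_mul, abs_neg_one_zpow, one_mul]
  have h2 : |Real.sin (Real.pi * ((k : ZMod n).valMinAbs : ℤ) / n)| =
      |Real.sin (Real.pi * cyclicNorm (k : ZMod n) / n)| := by
    rw [cyclicNorm, Nat.cast_natAbs, Int.cast_abs]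
    rcases abs_cases ((((k : ZMod n).valMinAbs : ℤ)) : ℝ) with h | h
    · rw [h.1]
    · rw [h.1, mul_neg, neg_div, Real.sin_neg, abs_neg]
  rw [h1, h2, abs_of_nonneg]
  have hle : (cyclicNorm (k : ZMod n) : ℝ) ≤ n := by
    exact_mod_cast (cyclicNorm_le _).trans (Nat.div_le_self _ _)
  apply Real.sin_nonneg_of_nonneg_of_le_pi
  · have := Real.pi_pos
    positivity
  · rw [div_le_iff₀ hn0]
    exact mul_le_mul_of_nonneg_left hle Real.pi_pos.le

theorem exists_regularPolygon_equiv {n : ℕ} (hn : 2 ≤ n) :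
    ∃ e : ZMod n ≃ RegularPolygon n, ∀ x y, dist (e x) (e y) = chord n (cyclicNorm (x - y)) := by
  have : NeZero n := ⟨by omega⟩
  let f : ZMod n → RegularPolygon n := fun x =>
    ⟨regularPolygonVertex n ⟨x.val, ZMod.val_lt x⟩, Set.mem_range_self _⟩
  have hf : ∀ x y, dist (f x) (f y) = chord n (cyclicNorm (x - y)) := by
    intro x y
    have h := abs_sin_pi_mul_div_eq (n := n) ((x.val : ℤ) - y.val)
    push_cast at h
    rw [ZMod.natCast_zmod_val, ZMod.natCast_zmod_val] at h
    rw [Subtype.dist_eq, dist_regularPolygonVertex hn, chord, ← h]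
  have hinj : Function.Injective f := by
    intro x y hxy
    have h1 := hf x y
    rw [hxy, dist_self] at h1
    by_contra hne
    have h0 : 0 < cyclicNorm (x - y) := by
      rw [Nat.pos_iff_ne_zero, Ne, cyclicNorm_eq_zero, sub_eq_zero]
      exact hne
    have hlt : cyclicNorm (x - y) < n := lt_of_le_of_lt (cyclicNorm_le _) (by omega)
    have hn0 : (0 : ℝ) < n := by exact_mod_cast Nat.pos_of_neZero n
    have h2 : 0 < Real.sin (Real.pi * cyclicNorm (x - y) / n) := by
      have h0' : (0 : ℝ) < cyclicNorm (x - y) := by exact_mod_cast h0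
      have hlt' : (cyclicNorm (x - y) : ℝ) < n := by exact_mod_cast hlt
      apply Real.sin_pos_of_pos_of_lt_pi
      · have := Real.pi_pos
        positivity
      · rw [div_lt_iff₀ hn0]
        exact mul_lt_mul_of_pos_left hlt' Real.pi_pos
    have := div_pos h2 (sin_pi_div_pos hn)
    rw [chord] at h1
    exact this.ne h1
  have hsurj : Function.Surjective f := by
    rintro ⟨_, k, rfl⟩
    refine ⟨((k : ℕ) : ZMod n), Subtype.ext ?_⟩
    simp only [f]
    congr 1
    exact Fin.ext (ZMod.val_natCast_of_lt k.isLt)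
  exact ⟨Equiv.ofBijective f ⟨hinj, hsurj⟩, hf⟩

/-- Repeated steps of `1` from one endpoint give the upper bound. Conversely `cyclicNorm` is
subadditive and at most `1` on an edge, so no walk is shorter. -/
theorem dist_eq_cyclicNorm {n : ℕ} {G : SimpleGraph (ZMod n)} (hconn : G.Connected)
    (hadj : ∀ u v, G.Adj u v ↔ u - v = 1 ∨ v - u = 1) (x y : ZMod n) :
    G.dist x y = cyclicNorm (x - y) := by
  apply le_antisymm
  · have hstep : ∀ (k : ℕ) (u : ZMod n), G.dist (u + k) u ≤ k := by
      intro k u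
      induction k with
      | zero => simp
      | succ k ih =>
        have h1 : G.dist (u + (k + 1 : ℕ)) (u + k) = 1 := by
          rw [SimpleGraph.dist_eq_one_iff_adj]
          exact (hadj _ _).mpr (Or.inl (by push_cast; ring))
        have := hconn.dist_triangle (u := u + (k + 1 : ℕ)) (v := u + k) (w := u)
        omega
    have hxy : ((x - y).valMinAbs : ZMod n) = x - y := ZMod.coe_valMinAbs _
    rcases Int.natAbs_eq (x - y).valMinAbs with h | h
    · have := hstep (cyclicNorm (x - y)) y
      rw [h, Int.cast_natCast] at hxy
      rwa [cyclicNorm, hxy, add_sub_cancel] at this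
    · have := hstep (cyclicNorm (x - y)) x
      rw [h, Int.cast_neg, Int.cast_natCast, neg_eq_iff_eq_neg, neg_sub] at hxy
      rw [cyclicNorm, hxy, add_sub_cancel] at this
      rwa [SimpleGraph.dist_comm]
  · obtain ⟨p, hp⟩ := hconn.exists_walk_length_eq_dist x y
    rw [← hp]
    clear hp
    induction p with
    | nil => exact (cyclicNorm_eq_zero.mpr (sub_self _)).le
    | @cons a b c h p ih =>
      have h1 : cyclicNorm (a - b) ≤ 1 := by
        rcases (hadj a b).mp h with h | h
        · rw [h]
          exact cyclicNorm_one_le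
        · rw [← cyclicNorm_neg, neg_sub, h]
          exact cyclicNorm_one_le
      have h2 := cyclicNorm_add_le (a - b) (b - c)
      rw [sub_add_sub_cancel] at h2
      rw [SimpleGraph.Walk.length_cons]
      omega

theorem exists_cycleSpace_equiv {n : ℕ} (hn : 2 ≤ n) :
    ∃ e : ZMod n ≃ CycleSpace n, ∀ x y, dist (e x) (e y) = (cyclicNorm (x - y) : ℝ) := by
  obtain ⟨m, rfl⟩ := Nat.exists_eq_add_of_le' hn
  refine ⟨⟨fun x => ⟨(x : Fin (m + 2))⟩, fun a => (a.vertex : Fin (m + 2)), fun _ => rfl,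
    fun _ => rfl⟩, fun x y => ?_⟩
  exact congrArg Nat.cast (dist_eq_cyclicNorm (n := m + 2) (G := SimpleGraph.cycleGraph (m + 2))
    SimpleGraph.cycleGraph_connected (fun _ _ => SimpleGraph.cycleGraph_adj) x y)

end Models

/-! ### Non-isometric groups with the same multiset of lengths -/

section NotIdentified

theorem formalMagnitude_eq_of_rowPoly_eq {X : Type u} [MetricSpace X] [Fintype X] [Nonempty X]
    {A : Type v} [MetricSpace A] [Fintype A] {r : GenPoly} (hX : ∀ x : X, rowPoly x = r)
    (hA : ∀ a : A, rowPoly a = r) (hcard : Fintype.card X = Fintype.card A) :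
    formalMagnitude X = formalMagnitude A := by
  have hne : algebraMap GenPoly GenRat r ≠ 0 := by
    obtain ⟨x⟩ := ‹Nonempty X›
    rw [Ne, FaithfulSMul.algebraMap_eq_zero_iff, ← hX x]
    intro h
    have := constantCoeff_rowPoly x
    rw [h, map_zero] at this
    exact zero_ne_one this
  apply mul_right_cancel₀ hne
  rw [formalMagnitude_mul_of_rowPoly_eq hX, formalMagnitude_mul_of_rowPoly_eq hA, hcard]

theorem rowPoly_eq_of_dist_eq {X : Type u} [MetricSpace X] [Fintype X] {G : Type v}
    [AddCommGroup G] [Fintype G] {ℓ : G → ℝ} (e : G ≃ X)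
    (he : ∀ x y, dist (e x) (e y) = ℓ (x - y)) (x : X) :
    rowPoly x = ∑ g : G, AddMonoidAlgebra.single (ℓ g).toNNReal 1 := by
  obtain ⟨g, rfl⟩ := e.surjective x
  rw [rowPoly]
  symm
  refine Fintype.sum_equiv ((Equiv.subLeft g).trans e) _ _ fun h => ?_
  congr 1
  rw [← Real.toNNReal_coe (r := nndist _ _), coe_nndist, Equiv.trans_apply, he,
    Equiv.subLeft_apply, sub_sub_cancel]

/-- A length on an abelian group defines a homogeneous metric whose row sum depends only on the
multiset of lengths; `hsum` expresses equality of these multisets. `ULift` only adjusts the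
universe. -/
theorem not_identified_of_length {A : Type v} [MetricSpace A] [Fintype A] {n : ℕ} [NeZero n]
    {D : ℕ → ℝ} (e : ZMod n ≃ A) (he : ∀ x y, dist (e x) (e y) = D (cyclicNorm (x - y)))
    {G : Type} [AddCommGroup G] [Fintype G] {ℓ : G → ℝ} (h0 : ℓ 0 = 0)
    (hneg : ∀ g, ℓ (-g) = ℓ g) (hpos : ∀ g, g ≠ 0 → 0 < ℓ g)
    (hadd : ∀ g h, ℓ (g + h) ≤ ℓ g + ℓ h)
    (hsum : ∀ F : ℝ → GenPoly, ∑ g : G, F (ℓ g) = ∑ z : ZMod n, F (D (cyclicNorm z)))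
    (hcard : Fintype.card G = n)
    (hiso : ∀ f : A → G, (∀ a b, ℓ (f a - f b) = dist a b) → ¬ Function.Surjective f) :
    ¬ IdentifiedByFormalMagnitude.{u, v} A := by
  intro hid
  let hG : MetricSpace (ULift.{u} G) :=
    { dist := fun x y => ℓ (x.down - y.down)
      dist_self := fun x => by rw [sub_self, h0]
      dist_comm := fun x y => by rw [← hneg, neg_sub]
      dist_triangle := fun x y z => by
        have := hadd (x.down - y.down) (y.down - z.down)
        rwa [sub_add_sub_cancel] at this
      eq_of_dist_eq_zero := fun {x y} h => by
        by_contra hne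
        have hne' : x.down - y.down ≠ 0 := fun h' => hne (ULift.ext _ _ (sub_eq_zero.mp h'))
        exact (hpos _ hne').ne' h }
  have hd : ∀ x y : ULift.{u} G, dist x y = ℓ (x.down - y.down) := fun _ _ => rfl
  have h1 : ∀ x : ULift.{u} G, rowPoly x = _ :=
    rowPoly_eq_of_dist_eq (ℓ := ℓ) Equiv.ulift.symm fun _ _ => rfl
  have h2 : ∀ a : A, rowPoly a = _ :=
    rowPoly_eq_of_dist_eq (ℓ := fun z => D (cyclicNorm z)) e he
  rw [hsum fun t => AddMonoidAlgebra.single t.toNNReal 1] at h1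
  have hc : Fintype.card (ULift.{u} G) = Fintype.card A := by
    rw [Fintype.card_ulift, hcard, ← Fintype.card_congr e, ZMod.card]
  obtain ⟨φ⟩ := hid (ULift.{u} G) (formalMagnitude_eq_of_rowPoly_eq h1 h2 hc)
  refine hiso (fun a => (φ.symm a).down) (fun a b => ?_)
    (ULift.down_surjective.comp φ.symm.surjective)
  rw [← hd, φ.symm.dist_eq]

theorem sum_cyclicNorm {M : Type*} [AddCommMonoid M] (n : ℕ) [NeZero n] (g : ℕ → M) :
    ∑ z : ZMod n, g (cyclicNorm z) = ∑ k ∈ Finset.range n, g (min k (n - k)) := by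
  refine Finset.sum_nbij' (fun z => z.val) (fun k => (k : ZMod n)) ?_ ?_ ?_ ?_ ?_
  · intro z _
    exact Finset.mem_range.mpr (ZMod.val_lt z)
  · intro k _
    exact Finset.mem_univ _
  · intro z _
    exact ZMod.natCast_zmod_val z
  · intro k hk
    exact ZMod.val_natCast_of_lt (Finset.mem_range.mp hk)
  · intro z _
    rw [cyclicNorm, ZMod.valMinAbs_natAbs_eq_min]

/-- The layered length on `ZMod 2 × ZMod m`: points of different layers are as far apart as
antipodes of points at their cyclic distance. -/
def layerNorm {m : ℕ} (g : ZMod 2 × ZMod m) : ℕ :=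
  if g.1 = 0 then cyclicNorm g.2 else m - cyclicNorm g.2

theorem layerNorm_le {m : ℕ} [NeZero m] (g : ZMod 2 × ZMod m) : layerNorm g ≤ m := by
  have := cyclicNorm_le g.2
  rw [layerNorm]
  split_ifs <;> omega

theorem layerNorm_neg {m : ℕ} (g : ZMod 2 × ZMod m) : layerNorm (-g) = layerNorm g := by
  simp [layerNorm, cyclicNorm_neg]

theorem layerNorm_eq_zero {m : ℕ} [NeZero m] {g : ZMod 2 × ZMod m} :
    layerNorm g = 0 ↔ g = 0 := by
  have h1 := cyclicNorm_le g.2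
  have h2 := Nat.pos_of_neZero m
  rw [layerNorm, Prod.ext_iff]
  split_ifs with h
  · simp [cyclicNorm_eq_zero, h]
  · simp only [Prod.fst_zero, h, false_and, iff_false]
    omega

theorem layerNorm_add_le {m : ℕ} [NeZero m] (g h : ZMod 2 × ZMod m) :
    layerNorm (g + h) ≤ layerNorm g + layerNorm h := by
  obtain ⟨a, i⟩ := g
  obtain ⟨b, j⟩ := h
  have h01 : ∀ c : ZMod 2, c = 0 ∨ c = 1 := by decide
  have h10 : (1 : ZMod 2) ≠ 0 := by decide
  have h11 : (1 : ZMod 2) + 1 = 0 := by decide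
  have hi := cyclicNorm_le i
  have hj := cyclicNorm_le j
  have hij := cyclicNorm_le (i + j)
  have t1 := cyclicNorm_add_le i j
  have t2 := cyclicNorm_add_le (i + j) (-i)
  have t3 := cyclicNorm_add_le (i + j) (-j)
  rw [add_neg_cancel_comm, cyclicNorm_neg] at t2
  rw [add_neg_cancel_right, cyclicNorm_neg] at t3
  rcases h01 a with rfl | rfl <;> rcases h01 b with rfl | rfl <;>
    simp only [layerNorm, Prod.mk_add_mk, add_zero, zero_add, h11, h10, if_true, if_false] <;>
    omega

/-- The residues `k` and `m + k` of `ZMod (2 * m)` have norms `k` and `m - k`, the same unordered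
pair as the two elements over `k` in the layers. -/
theorem sum_layerNorm {M : Type*} [AddCommMonoid M] (m : ℕ) [NeZero m] (g : ℕ → M) :
    ∑ x : ZMod 2 × ZMod m, g (layerNorm x) = ∑ z : ZMod (2 * m), g (cyclicNorm z) := by
  have h10 : (1 : ZMod 2) ≠ 0 := by decide
  have h2 : ∀ f : ZMod 2 → M, ∑ c : ZMod 2, f c = f 0 + f 1 := fun f => Fin.sum_univ_two f
  rw [sum_cyclicNorm, Fintype.sum_prod_type, h2]
  simp only [layerNorm, if_true, h10, if_false]
  rw [sum_cyclicNorm m g, sum_cyclicNorm m fun k => g (m - k), ← Finset.sum_add_distrib, two_mul,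
    Finset.sum_range_add, ← Finset.sum_add_distrib]
  refine Finset.sum_congr rfl fun k hk => ?_
  have hk' := Finset.mem_range.mp hk
  rw [show min k (m + m - k) = k by omega, show min (m + k) (m + m - (m + k)) = m - k by omega]
  rcases le_total k (m - k) with h | h
  · rw [min_eq_left h]
  · rw [min_eq_right h, add_comm, show m - (m - k) = k by omega]

theorem cyclicNorm_one {n : ℕ} (hn : 2 ≤ n) : cyclicNorm (1 : ZMod n) = 1 := by
  have h := cyclicNorm_one_le (n := n)
  have : Fact (1 < n) := ⟨hn⟩
  have h0 : cyclicNorm (1 : ZMod n) ≠ 0 := by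
    rw [Ne, cyclicNorm_eq_zero]
    exact one_ne_zero
  omega

theorem not_identified_of_even {A : Type v} [MetricSpace A] [Fintype A] {m : ℕ} (hm : 3 ≤ m)
    {D : ℕ → ℝ} (e : ZMod (2 * m) ≃ A) (he : ∀ x y, dist (e x) (e y) = D (cyclicNorm (x - y)))
    (h0 : D 0 = 0) (hmono : StrictMonoOn D (Set.Iic m))
    (hsub : ∀ i j k, i ≤ m → j ≤ m → k ≤ m → k ≤ i + j → D k ≤ D i + D j) :
    ¬ IdentifiedByFormalMagnitude.{u, v} A := by
  have : NeZero m := ⟨by omega⟩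
  refine not_identified_of_length e he (G := ZMod 2 × ZMod m) (ℓ := fun g => D (layerNorm g))
    ?_ ?_ ?_ ?_ ?_ ?_ ?_
  · rw [layerNorm_eq_zero.mpr rfl, h0]
  · intro g
    simp only [layerNorm_neg]
  · intro g hg
    have h1 : 0 < layerNorm g := by
      rw [Nat.pos_iff_ne_zero, Ne, layerNorm_eq_zero]
      exact hg
    have := hmono (Set.mem_Iic.mpr (Nat.zero_le m)) (Set.mem_Iic.mpr (layerNorm_le g)) h1
    rwa [h0] at this
  · intro g h
    exact hsub _ _ _ (layerNorm_le g) (layerNorm_le h) (layerNorm_le _) (layerNorm_add_le g h)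
  · intro F
    exact sum_layerNorm m fun k => F (D k)
  · simp [ZMod.card]
  · intro f hf hsurj
    -- Changing layers costs at least `m - m / 2`, which exceeds `1` because `3 ≤ m`. Hence steps of
    -- length `D 1` stay in one layer, and the image of the whole cycle does too.
    have hstep : ∀ x : ZMod (2 * m), (f (e (x + 1))).1 = (f (e x)).1 := by
      intro x
      have h1 := hf (e (x + 1)) (e x)
      rw [he, add_sub_cancel_left, cyclicNorm_one (by omega)] at h1
      have h2 := hmono.injOn (Set.mem_Iic.mpr (layerNorm_le _))
        (Set.mem_Iic.mpr (by omega : 1 ≤ m)) h1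
      rw [layerNorm] at h2
      split_ifs at h2 with h3
      · exact sub_eq_zero.mp h3
      · have := cyclicNorm_le (f (e (x + 1)) - f (e x)).2
        omega
    have hconst : ∀ k : ℕ, (f (e (k : ZMod (2 * m)))).1 = (f (e 0)).1 := by
      intro k
      induction k with
      | zero => simp
      | succ k ih => rw [Nat.cast_succ, hstep, ih]
    obtain ⟨a, ha⟩ := hsurj ((f (e 0)).1 + 1, 0)
    obtain ⟨x, rfl⟩ := e.surjective a
    have h1 := hconst x.val
    rw [ZMod.natCast_zmod_val, ha] at h1
    exact absurd (add_eq_left.mp h1) (by decide)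

theorem not_identified_cycleSpace {n : ℕ} (h : Even n ∧ 6 ≤ n) :
    ¬ IdentifiedByFormalMagnitude.{u, 0} (CycleSpace n) := by
  obtain ⟨⟨m, rfl⟩, hn⟩ := h
  rw [← two_mul] at hn ⊢
  obtain ⟨e, he⟩ := exists_cycleSpace_equiv (n := 2 * m) (by omega)
  exact not_identified_of_even (by omega) (D := fun k => (k : ℝ)) e he (by simp)
    (fun _ _ _ _ h => Nat.cast_lt.mpr h) (fun _ _ _ _ _ _ h => by exact_mod_cast h)

theorem chord_zero (n : ℕ) : chord n 0 = 0 := by simp [chord]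

theorem chord_one {n : ℕ} (hn : 2 ≤ n) : chord n 1 = 1 := by
  rw [chord, Nat.cast_one, mul_one, div_self (sin_pi_div_pos hn).ne']

theorem pi_mul_div_mem {n k : ℕ} (hk : 2 * k ≤ n) :
    Real.pi * k / n ∈ Set.Icc 0 (Real.pi / 2) := by
  have hpi := Real.pi_pos
  refine ⟨by positivity, ?_⟩
  rcases Nat.eq_zero_or_pos n with rfl | hn
  · simp only [Nat.cast_zero, div_zero]
    positivity
  · have hn' : (0 : ℝ) < n := by exact_mod_cast hn
    have hk' : (2 * k : ℝ) ≤ n := by exact_mod_cast hk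
    rw [div_le_div_iff₀ hn' two_pos]
    nlinarith

theorem chord_lt_chord {n i j : ℕ} (hn : 2 ≤ n) (hj : 2 * j ≤ n) (hij : i < j) :
    chord n i < chord n j := by
  have hpi := Real.pi_pos
  have hn' : (0 : ℝ) < n := by exact_mod_cast (by omega : 0 < n)
  have hi := pi_mul_div_mem (n := n) (k := i) (by omega)
  have hj := pi_mul_div_mem hj
  have hij' : (i : ℝ) < j := by exact_mod_cast hij
  rw [chord, chord]
  refine div_lt_div_of_pos_right ?_ (sin_pi_div_pos hn)
  refine Real.sin_lt_sin_of_lt_of_le_pi_div_two (by linarith [hi.1]) hj.2 ?_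
  gcongr

theorem chord_add_le {n i j : ℕ} (hn : 2 ≤ n) (hi : 2 * i ≤ n) (hj : 2 * j ≤ n) :
    chord n (i + j) ≤ chord n i + chord n j := by
  have hi := pi_mul_div_mem hi
  have hj := pi_mul_div_mem hj
  have hpi := Real.pi_pos
  rw [chord, chord, chord, ← add_div]
  refine div_le_div_of_nonneg_right ?_ (sin_pi_div_pos hn).le
  rw [Nat.cast_add, mul_add, add_div, Real.sin_add]
  have h1 := Real.sin_nonneg_of_nonneg_of_le_pi hi.1 (by linarith [hi.2])
  have h2 := Real.sin_nonneg_of_nonneg_of_le_pi hj.1 (by linarith [hj.2])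
  nlinarith [Real.cos_le_one (Real.pi * i / n), Real.cos_le_one (Real.pi * j / n)]

theorem not_identified_regularPolygon_of_even {n : ℕ} (h : Even n ∧ 6 ≤ n) :
    ¬ IdentifiedByFormalMagnitude.{u, 0} (RegularPolygon n) := by
  obtain ⟨⟨m, rfl⟩, hn⟩ := h
  rw [← two_mul] at hn ⊢
  obtain ⟨e, he⟩ := exists_regularPolygon_equiv (n := 2 * m) (by omega)
  have hmono : StrictMonoOn (chord (2 * m)) (Set.Iic m) := fun i _ j hj hij =>
    chord_lt_chord (by omega) (Nat.mul_le_mul_left 2 hj) hij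
  refine not_identified_of_even (by omega) e he (chord_zero _) hmono ?_
  intro i j k hi hj hk hkij
  have hj0 : 0 ≤ chord (2 * m) j := by
    rw [← chord_zero (2 * m)]
    exact hmono.monotoneOn (Set.mem_Iic.mpr (Nat.zero_le m)) hj (Nat.zero_le j)
  rcases le_total k i with h | h
  · exact (hmono.monotoneOn hk hi h).trans (le_add_of_nonneg_right hj0)
  · obtain ⟨l, rfl⟩ := Nat.exists_eq_add_of_le h
    refine (chord_add_le (by omega) (by omega) (by omega)).trans ?_
    gcongr
    exact hmono.monotoneOn (Set.mem_Iic.mpr (by omega)) hj (by omega)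

/-- A length on `ZMod 3 × ZMod 3` that separates the four subgroups of order three. -/
def lineNorm (g : ZMod 3 × ZMod 3) : ℕ :=
  if g.1 = 0 then if g.2 = 0 then 0 else 2
  else if g.2 = 0 then 1 else if g.1 = g.2 then 3 else 4

/-- In degrees: `sin 80 - sin 40 = 2 cos 60 sin 20 = sin 20`. -/
theorem chord_nine_four : chord 9 4 = chord 9 1 + chord 9 2 := by
  rw [chord, chord, chord, ← add_div]
  congr 1
  have h := Real.sin_sub_sin (Real.pi * (4 : ℕ) / (9 : ℕ)) (Real.pi * (2 : ℕ) / (9 : ℕ))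
  have h1 : (Real.pi * (4 : ℕ) / (9 : ℕ) - Real.pi * (2 : ℕ) / (9 : ℕ)) / 2 =
      Real.pi * (1 : ℕ) / (9 : ℕ) := by
    push_cast
    ring
  have h2 : (Real.pi * (4 : ℕ) / (9 : ℕ) + Real.pi * (2 : ℕ) / (9 : ℕ)) / 2 = Real.pi / 3 := by
    push_cast
    ring
  rw [h1, h2, Real.cos_pi_div_three] at h
  linarith

theorem not_identified_regularPolygon_nine :
    ¬ IdentifiedByFormalMagnitude.{u, 0} (RegularPolygon 9) := by
  obtain ⟨e, he⟩ := exists_regularPolygon_equiv (n := 9) (by omega)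
  have hmono : StrictMonoOn (chord 9) (Set.Iic 4) := fun i _ j hj hij => by
    rw [Set.mem_Iic] at hj
    exact chord_lt_chord (by omega) (by omega) hij
  have hle : ∀ g, lineNorm g ≤ 4 := by decide
  have hmono' : ∀ {i j : ℕ}, i ≤ j → j ≤ 4 → chord 9 i ≤ chord 9 j := fun hij hj =>
    hmono.monotoneOn (Set.mem_Iic.mpr (hij.trans hj)) (Set.mem_Iic.mpr hj) hij
  have hnn : ∀ g, 0 ≤ chord 9 (lineNorm g) := fun g => by
    rw [← chord_zero 9]
    exact hmono' (Nat.zero_le _) (hle g)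
  refine not_identified_of_length e he (G := ZMod 3 × ZMod 3)
    (ℓ := fun g => chord 9 (lineNorm g)) ?_ ?_ ?_ ?_ ?_ ?_ ?_
  · exact chord_zero 9
  · have h : ∀ g, lineNorm (-g) = lineNorm g := by decide
    intro g
    simp only [h]
  · have h : ∀ g, g ≠ 0 → 0 < lineNorm g := by decide
    intro g hg
    rw [← chord_zero 9]
    exact hmono (by simp) (hle g) (h g hg)
  -- On a common line the sum is no longer than a summand. Nonzero elements of different lines have
  -- different lengths, so together they reach at least `chord 9 1 + chord 9 2`, which is the
  -- diameter.
  · have h : ∀ g h, lineNorm (g + h) ≤ lineNorm g ∨ lineNorm (g + h) ≤ lineNorm h ∨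
        (1 ≤ lineNorm g ∧ 2 ≤ lineNorm h) ∨ (2 ≤ lineNorm g ∧ 1 ≤ lineNorm h) := by decide
    intro g k
    have h4 : chord 9 (lineNorm (g + k)) ≤ chord 9 1 + chord 9 2 := by
      rw [← chord_nine_four]
      exact hmono' (hle _) le_rfl
    rcases h g k with h | h | h | h
    · linarith [hmono' h (hle g), hnn k]
    · linarith [hmono' h (hle k), hnn g]
    · linarith [hmono' h.1 (hle g), hmono' h.2 (hle k)]
    · linarith [hmono' h.1 (hle g), hmono' h.2 (hle k)]
  · intro F
    have h : (Finset.univ : Finset (ZMod 3 × ZMod 3)).val.map lineNorm =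
        (Finset.univ : Finset (ZMod 9)).val.map cyclicNorm := by decide
    have := congrArg (fun s : Multiset ℕ => (s.map fun k => F (chord 9 k)).sum) h
    simp only [Multiset.map_map] at this
    exact this
  · decide
  · intro f hf hsurj
    -- The 9-gon has no equilateral triangle of side `1`, whereas the line through `(1, 0)` is one.
    have h : ∀ x y : ZMod 9, cyclicNorm x = 1 → cyclicNorm y = 1 → cyclicNorm (x + y) ≠ 1 := by
      decide
    have hnorm : ∀ x y : ZMod 9, lineNorm (f (e x) - f (e y)) = 1 → cyclicNorm (x - y) = 1 := by
      intro x y hxy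
      have h1 := hf (e x) (e y)
      rw [he] at h1
      rw [hxy] at h1
      exact (hmono.injOn (by simp) (Set.mem_Iic.mpr (cyclicNorm_le _)) h1).symm
    obtain ⟨a, ha⟩ := (hsurj.comp e.surjective) (0, 0)
    obtain ⟨b, hb⟩ := (hsurj.comp e.surjective) (1, 0)
    obtain ⟨c, hc⟩ := (hsurj.comp e.surjective) (2, 0)
    rw [Function.comp_apply] at ha hb hc
    refine h (a - b) (b - c) (hnorm a b ?_) (hnorm b c ?_) ?_
    · rw [ha, hb]
      decide
    · rw [hb, hc]
      decide
    · rw [sub_add_sub_cancel]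
      apply hnorm a c
      rw [ha, hc]
      decide

end NotIdentified

/-! ### Cycle structure of two-regular graphs -/

section TwoRegular

variable {V : Type*} [Fintype V] [DecidableEq V] {N : V → Finset V}

/-- In a two-regular graph every vertex lies on a cycle that is closed under adjacency. -/
theorem exists_cycle_of_two_regular (hcard : ∀ x, (N x).card = 2)
    (hsymm : ∀ x y, y ∈ N x → x ∈ N y) (hirr : ∀ x, x ∉ N x) (x₀ : V) :
    ∃ ℓ : ℕ, 3 ≤ ℓ ∧ ∃ g : ZMod ℓ → V, Function.Injective g ∧ g 0 = x₀ ∧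
      ∀ z, N (g z) = {g (z - 1), g (z + 1)} := by
  have hother : ∀ x y, y ∈ N x → ∃ z, y ≠ z ∧ N x = {y, z} := by
    intro x y hy
    obtain ⟨a, b, hab, h⟩ := Finset.card_eq_two.mp (hcard x)
    rw [h, Finset.mem_insert, Finset.mem_singleton] at hy
    rcases hy with rfl | rfl
    · exact ⟨b, hab, h⟩
    · exact ⟨a, hab.symm, by rw [h, Finset.pair_comm]⟩
  obtain ⟨x₁, hx₁⟩ : (N x₀).Nonempty := by
    rw [← Finset.card_pos, hcard]
    exact two_pos
  obtain ⟨f, hf0, hfN, hfne⟩ : ∃ f : ℕ → V, f 0 = x₀ ∧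
      (∀ i, N (f (i + 1)) = {f i, f (i + 2)}) ∧ ∀ i, f i ≠ f (i + 2) := by
    -- A walk without backtracking: the state is a directed edge, and `other` picks the neighbour of
    -- its head that differs from its tail.
    choose! other hne hN using hother
    let step : {p : V × V // p.1 ∈ N p.2} → {p : V × V // p.1 ∈ N p.2} := fun p =>
      ⟨(p.1.2, other p.1.2 p.1.1), hsymm _ _ (by
        change other p.1.2 p.1.1 ∈ N p.1.2
        rw [hN _ _ p.2, Finset.mem_insert, Finset.mem_singleton]
        exact Or.inr rfl)⟩
    let s : ℕ → {p : V × V // p.1 ∈ N p.2} := fun i => step^[i] ⟨(x₀, x₁), hsymm _ _ hx₁⟩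
    have hs : ∀ i, s (i + 1) = step (s i) := fun i => Function.iterate_succ_apply' _ _ _
    have h1 : ∀ i, (s (i + 1)).1.1 = (s i).1.2 := fun i => by rw [hs]
    have h2 : ∀ i, (s (i + 2)).1.1 = other (s i).1.2 (s i).1.1 := fun i => by rw [h1, hs]
    refine ⟨fun i => (s i).1.1, rfl, fun i => ?_, fun i => ?_⟩
    · change N (s (i + 1)).1.1 = {(s i).1.1, (s (i + 2)).1.1}
      rw [h1, h2]
      exact hN _ _ (s i).2
    · change (s i).1.1 ≠ (s (i + 2)).1.1
      rw [h2]
      exact hne _ _ (s i).2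
  have hadj : ∀ i, f (i + 1) ∈ N (f i) := by
    intro i
    apply hsymm
    rw [hfN]
    exact Finset.mem_insert_self _ _
  have hrep : ∃ k, ∃ j < k, f k = f j := by
    obtain ⟨i, j, hne, hij⟩ := Finite.exists_ne_map_eq_of_infinite f
    rcases lt_or_gt_of_ne hne with h | h
    · exact ⟨j, i, h, hij.symm⟩
    · exact ⟨i, j, h, hij⟩
  classical
  obtain ⟨ℓ, ⟨j, hjl, hfj⟩, hmin⟩ : ∃ ℓ, (∃ j < ℓ, f ℓ = f j) ∧
      ∀ k < ℓ, ¬ ∃ j < k, f k = f j :=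
    ⟨Nat.find hrep, Nat.find_spec hrep, fun k hk => Nat.find_min hrep hk⟩
  have hinj : ∀ i j, i < ℓ → j < ℓ → f i = f j → i = j := by
    intro i j hi hj hij
    rcases lt_trichotomy i j with h | h | h
    · exact absurd ⟨i, h, hij.symm⟩ (hmin j hj)
    · exact h
    · exact absurd ⟨j, h, hij⟩ (hmin i hi)
  obtain ⟨k, rfl⟩ : ∃ k, ℓ = k + 1 := ⟨ℓ - 1, by omega⟩
  have hj1 : j + 1 ≠ k + 1 := by
    intro h
    obtain rfl : j = k := by omega
    have := hadj j
    rw [hfj] at this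
    exact hirr _ this
  have hj2 : j + 2 ≠ k + 1 := by
    intro h
    rw [← h] at hfj
    exact hfne j hfj.symm
  -- The first repetition closes up at the start. Otherwise `f k`, a neighbour of `f (k + 1) = f j`,
  -- would be `f (j - 1)` or `f (j + 1)`, which injectivity before the first repetition rules out.
  have hj0 : j = 0 := by
    by_contra h0
    obtain ⟨i, rfl⟩ : ∃ i, j = i + 1 := ⟨j - 1, by omega⟩
    have h1 := hsymm _ _ (hadj k)
    rw [hfj, hfN, Finset.mem_insert, Finset.mem_singleton] at h1
    rcases h1 with h1 | h1
    · have := hinj _ _ (by omega) (by omega) h1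
      omega
    · have := hinj _ _ (by omega) (by omega) h1
      omega
  subst hj0
  -- The walk is determined by two consecutive vertices, so the induction carries two consecutive
  -- equalities.
  have hper : ∀ i, f (i + (k + 1)) = f i ∧ f (i + 1 + (k + 1)) = f (i + 1) := by
    intro i
    induction i with
    | zero =>
      refine ⟨by rw [Nat.zero_add, hfj], ?_⟩
      have h1 := hfN k
      rw [hfj] at h1
      have h2 := hadj 0
      rw [h1, Finset.mem_insert, Finset.mem_singleton] at h2
      rcases h2 with h2 | h2
      · have := hinj _ _ (by omega) (by omega) h2
        omega
      · rw [h2]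
        congr 1
        omega
    | succ i ih =>
      refine ⟨ih.2, ?_⟩
      have h1 := hfN (i + (k + 1))
      rw [show i + (k + 1) + 1 = i + 1 + (k + 1) by omega, ih.2, hfN, ih.1,
        show i + (k + 1) + 2 = i + 1 + 1 + (k + 1) by omega] at h1
      have h2 : f (i + 2) ∈ ({f i, f (i + 1 + 1 + (k + 1))} : Finset V) := by
        rw [← h1]
        simp
      rw [Finset.mem_insert, Finset.mem_singleton] at h2
      rcases h2 with h2 | h2
      · exact absurd h2.symm (hfne i)
      · exact h2.symm
  have hmod : ∀ i, f (i % (k + 1)) = f i :=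
    Function.Periodic.map_mod_nat fun i => (hper i).1
  have hg : ∀ i : ℕ, f (ZMod.val (i : ZMod (k + 1))) = f i := by
    intro i
    rw [ZMod.val_natCast, hmod]
  refine ⟨k + 1, by omega, fun z => f z.val, ?_, ?_, ?_⟩
  · intro y z hyz
    exact ZMod.val_injective _ (hinj _ _ (ZMod.val_lt y) (ZMod.val_lt z) hyz)
  · change f (ZMod.val 0) = x₀
    rw [ZMod.val_zero, hf0]
  · intro z
    have hz : z = ((z.val + k + 1 : ℕ) : ZMod (k + 1)) := by
      rw [add_assoc, Nat.cast_add, ZMod.natCast_self, add_zero, ZMod.natCast_zmod_val]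
    have hz1 : z - 1 = ((z.val + k : ℕ) : ZMod (k + 1)) := by
      nth_rewrite 1 [hz]
      push_cast
      ring
    have hz2 : z + 1 = ((z.val + k + 2 : ℕ) : ZMod (k + 1)) := by
      nth_rewrite 1 [hz]
      push_cast
      ring
    change N (f z.val) = {f (z - 1).val, f (z + 1).val}
    rw [hz1, hz2, hg, hg, ← hfN, ← hg (z.val + k + 1), ← hz]

omit [Fintype V] in
theorem three_le_card_of_closed (hcard : ∀ x, (N x).card = 2) (hirr : ∀ x, x ∉ N x)
    {S : Finset V} (hS : ∀ x ∈ S, N x ⊆ S) (hne : S.Nonempty) : 3 ≤ S.card := by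
  obtain ⟨x, hx⟩ := hne
  have h : insert x (N x) ⊆ S := Finset.insert_subset hx (hS x hx)
  have := Finset.card_le_card h
  rwa [Finset.card_insert_of_notMem (hirr x), hcard] at this

theorem closed_compl (hsymm : ∀ x y, y ∈ N x → x ∈ N y) {S : Finset V}
    (hS : ∀ x ∈ S, N x ⊆ S) : ∀ x ∈ Sᶜ, N x ⊆ Sᶜ := by
  intro x hx y hy
  rw [Finset.mem_compl] at hx ⊢
  exact fun hyS => hx (hS y hyS (hsymm x y hy))

theorem card_eq_or_of_closed (hcard : ∀ x, (N x).card = 2)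
    (hsymm : ∀ x y, y ∈ N x → x ∈ N y) (hirr : ∀ x, x ∉ N x) {S : Finset V}
    (hS : ∀ x ∈ S, N x ⊆ S) : S = Finset.univ ∨ S.card + 3 ≤ Fintype.card V := by
  by_cases h : (Sᶜ).Nonempty
  · right
    have h1 := three_le_card_of_closed hcard hirr (closed_compl hsymm hS) h
    have h2 := Finset.card_add_card_compl S
    omega
  · left
    rwa [Finset.not_nonempty_iff_eq_empty, Finset.compl_eq_empty_iff] at h

omit [Fintype V] in
theorem closed_image {ℓ : ℕ} [NeZero ℓ] {g : ZMod ℓ → V}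
    (hg : ∀ z, N (g z) = {g (z - 1), g (z + 1)}) :
    ∀ x ∈ Finset.univ.image g, N x ⊆ Finset.univ.image g := by
  intro x hx
  obtain ⟨z, _, rfl⟩ := Finset.mem_image.mp hx
  rw [hg, Finset.insert_subset_iff, Finset.singleton_subset_iff]
  exact ⟨Finset.mem_image_of_mem _ (Finset.mem_univ _),
    Finset.mem_image_of_mem _ (Finset.mem_univ _)⟩

omit [Fintype V] in
theorem card_image_cycle {ℓ : ℕ} [NeZero ℓ] {g : ZMod ℓ → V} (hinj : Function.Injective g) :
    (Finset.univ.image g).card = ℓ := by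
  rw [Finset.card_image_of_injective _ hinj, Finset.card_univ, ZMod.card]

/-- A two-regular graph with at most five vertices is a cycle. -/
theorem exists_cycle_of_card_le_five (hcard : ∀ x, (N x).card = 2)
    (hsymm : ∀ x y, y ∈ N x → x ∈ N y) (hirr : ∀ x, x ∉ N x) {n : ℕ}
    (hV : Fintype.card V = n) (hn0 : 0 < n) (hn : n ≤ 5) :
    ∃ g : ZMod n → V, Function.Injective g ∧ ∀ z, N (g z) = {g (z - 1), g (z + 1)} := by
  obtain ⟨x₀⟩ : Nonempty V := Fintype.card_pos_iff.mp (hV ▸ hn0)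
  obtain ⟨ℓ, hℓ, g, hinj, -, hg⟩ := exists_cycle_of_two_regular hcard hsymm hirr x₀
  have : NeZero ℓ := ⟨by omega⟩
  have h1 := card_image_cycle hinj
  rcases card_eq_or_of_closed hcard hsymm hirr (closed_image hg) with h | h
  · rw [h, Finset.card_univ, hV] at h1
    subst h1
    exact ⟨g, hinj, hg⟩
  · omega

/-- A two-regular graph on seven vertices is a cycle or contains a cycle of length four. -/
theorem exists_cycle_of_card_eq_seven (hcard : ∀ x, (N x).card = 2)
    (hsymm : ∀ x y, y ∈ N x → x ∈ N y) (hirr : ∀ x, x ∉ N x) (hV : Fintype.card V = 7) :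
    (∃ g : ZMod 7 → V, Function.Injective g ∧ ∀ z, N (g z) = {g (z - 1), g (z + 1)}) ∨
    ∃ g : ZMod 4 → V, Function.Injective g ∧ ∀ z, N (g z) = {g (z - 1), g (z + 1)} := by
  have key : ∀ x₀ : V, ((∃ g : ZMod 7 → V, Function.Injective g ∧
      ∀ z, N (g z) = {g (z - 1), g (z + 1)}) ∨
      ∃ g : ZMod 4 → V, Function.Injective g ∧ ∀ z, N (g z) = {g (z - 1), g (z + 1)}) ∨
      ∃ S : Finset V, x₀ ∈ S ∧ S.card = 3 ∧ ∀ x ∈ S, N x ⊆ S := by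
    intro x₀
    obtain ⟨ℓ, hℓ, g, hinj, h0, hg⟩ := exists_cycle_of_two_regular hcard hsymm hirr x₀
    have : NeZero ℓ := ⟨by omega⟩
    have h1 := card_image_cycle hinj
    rcases card_eq_or_of_closed hcard hsymm hirr (closed_image hg) with h | h
    · rw [h, Finset.card_univ, hV] at h1
      subst h1
      exact Or.inl (Or.inl ⟨g, hinj, hg⟩)
    · rw [h1, hV] at h
      obtain rfl | rfl : ℓ = 3 ∨ ℓ = 4 := by omega
      · exact Or.inr ⟨_, Finset.mem_image.mpr ⟨0, Finset.mem_univ _, h0⟩, h1, closed_image hg⟩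
      · exact Or.inl (Or.inr ⟨g, hinj, hg⟩)
  obtain ⟨x₀⟩ : Nonempty V := Fintype.card_pos_iff.mp (by omega)
  rcases key x₀ with h | ⟨S, hxS, hS3, hS⟩
  · exact h
  obtain ⟨y₀, hy₀⟩ : (Sᶜ).Nonempty := by
    rw [← Finset.card_pos, Finset.card_compl]
    omega
  rcases key y₀ with h | ⟨T, hyT, hT3, hT⟩
  · exact h
  -- Two triangles would be disjoint and leave a single vertex, too few for a closed set.
  exfalso
  have hdisj : S ∩ T = ∅ := by
    by_contra hne
    have h3 := three_le_card_of_closed hcard hirr (S := S ∩ T)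
      (fun x hx => Finset.subset_inter (hS x (Finset.mem_inter.mp hx).1)
        (hT x (Finset.mem_inter.mp hx).2)) (Finset.nonempty_iff_ne_empty.mpr hne)
    have h4 : S ∩ T = T := Finset.eq_of_subset_of_card_le Finset.inter_subset_right (by omega)
    rw [← h4] at hyT
    exact (Finset.mem_compl.mp hy₀) (Finset.mem_inter.mp hyT).1
  have hU : ∀ x ∈ S ∪ T, N x ⊆ S ∪ T := by
    intro x hx
    rcases Finset.mem_union.mp hx with h | h
    · exact (hS x h).trans Finset.subset_union_left
    · exact (hT x h).trans Finset.subset_union_right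
  have hUc : (S ∪ T).card = 6 := by
    have := Finset.card_union_add_card_inter S T
    rw [hdisj, Finset.card_empty] at this
    omega
  rcases card_eq_or_of_closed hcard hsymm hirr hU with h | h
  · rw [h, Finset.card_univ] at hUc
    omega
  · omega

end TwoRegular

/-! ### Reconstructing a space from its row sums -/

section Identified

theorem distCount_cast {X : Type u} [MetricSpace X] [Fintype X] (x : X) (t : ℝ≥0) :
    open scoped Classical in
    (Finset.univ.filter fun y : X => dist x y = (t : ℝ)).card = distCount x t := by
  classical
  rw [distCount]
  congr 1
  ext y
  simp only [Finset.mem_filter, Finset.mem_univ, true_and]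
  rw [← coe_nndist, NNReal.coe_inj]

theorem distCount_eq_of_rowPoly_eq {X : Type u} [MetricSpace X] [Fintype X] {A : Type v}
    [MetricSpace A] [Fintype A] {x : X} {a : A} (h : rowPoly x = rowPoly a) (t : ℝ≥0) :
    distCount x t = distCount a t := by
  have := congrArg (fun f : GenPoly => f.coeff t) h
  rw [coeff_rowPoly, coeff_rowPoly] at this
  exact_mod_cast this

section Model

variable {X : Type u} [MetricSpace X] [Fintype X] {A : Type v} [MetricSpace A] [Fintype A]
  {n : ℕ} [NeZero n] {D : ℕ → ℝ}

theorem exists_dist_eq_of_rowPoly_eq (e : ZMod n ≃ A)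
    (he : ∀ x y, dist (e x) (e y) = D (cyclicNorm (x - y)))
    (hrow : ∀ x : X, rowPoly x = rowPoly (e 0)) (x y : X) :
    ∃ k ≤ n / 2, dist x y = D k := by
  have h1 : 0 < distCount x (nndist x y) := distCount_pos.mpr ⟨y, rfl⟩
  rw [distCount_eq_of_rowPoly_eq (hrow x), distCount_pos] at h1
  obtain ⟨a, ha⟩ := h1
  obtain ⟨z, rfl⟩ := e.surjective a
  refine ⟨_, cyclicNorm_le (0 - z), ?_⟩
  rw [← he, ← coe_nndist, ← coe_nndist, ha]

-- The coefficients of a row sum count the points on each sphere, and injectivity of `D` turns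
-- spheres of the model into level sets of `cyclicNorm`.
open scoped Classical in
theorem card_dist_eq (e : ZMod n ≃ A)
    (he : ∀ x y, dist (e x) (e y) = D (cyclicNorm (x - y)))
    (hD : Set.InjOn D (Set.Iic (n / 2)))
    (hrow : ∀ x : X, rowPoly x = rowPoly (e 0)) (x : X) {k : ℕ} (hk : k ≤ n / 2) (hk0 : 0 ≤ D k) :
    (Finset.univ.filter fun y : X => dist x y = D k).card =
      (Finset.univ.filter fun z : ZMod n => cyclicNorm z = k).card := by
  obtain ⟨t, ht⟩ : ∃ t : ℝ≥0, (t : ℝ) = D k := ⟨⟨D k, hk0⟩, rfl⟩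
  rw [← ht, distCount_cast, distCount_eq_of_rowPoly_eq (hrow x), ← distCount_cast, ht]
  symm
  refine Finset.card_equiv e fun z => ?_
  simp only [Finset.mem_filter, Finset.mem_univ, true_and]
  rw [he, zero_sub, cyclicNorm_neg]
  exact ⟨fun h => by rw [h], fun h => hD (cyclicNorm_le z) hk h⟩

omit [Fintype A] in
theorem nonempty_isometryEquiv (e : ZMod n ≃ A)
    (he : ∀ x y, dist (e x) (e y) = D (cyclicNorm (x - y)))
    (hcard : Fintype.card X = n) {g : ZMod n → X} (hinj : Function.Injective g)
    (hg : ∀ i j, dist (g i) (g j) = D (cyclicNorm (i - j))) : Nonempty (X ≃ᵢ A) := by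
  have hbij : Function.Bijective g := by
    rw [Fintype.bijective_iff_injective_and_card, ZMod.card, hcard]
    exact ⟨hinj, rfl⟩
  have hiso : Isometry (fun x => e ((Equiv.ofBijective g hbij).symm x)) := by
    refine Isometry.of_dist_eq fun x y => ?_
    obtain ⟨i, rfl⟩ := hbij.2 x
    obtain ⟨j, rfl⟩ := hbij.2 y
    rw [hg, he]
    congr <;> exact (Equiv.ofBijective g hbij).symm_apply_apply _
  exact ⟨⟨(Equiv.ofBijective g hbij).symm.trans e, hiso⟩⟩

/-- The rigidity theorem for a cyclic model whose distances beyond the side `D 1 = 1` lie in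
`[D 2, 1 + D 2)`. -/
theorem rowPoly_eq_of_cyclicModel (e : ZMod n ≃ A)
    (he : ∀ x y, dist (e x) (e y) = D (cyclicNorm (x - y))) (hD1 : D 1 = 1)
    (h12 : 1 < D 2) (h2 : D 2 ≤ 2)
    (hD : ∀ k, 2 ≤ k → k ≤ n / 2 → D 2 ≤ D k ∧ D k < 1 + D 2)
    (h : formalMagnitude X = formalMagnitude A) :
    (∀ x : X, rowPoly x = rowPoly (e 0)) ∧ Fintype.card X = n := by
  have hA : ∀ a : A, rowPoly a = rowPoly (e 0) := fun a => by
    rw [rowPoly_eq_of_dist_eq (ℓ := fun z => D (cyclicNorm z)) e he,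
      rowPoly_eq_of_dist_eq (ℓ := fun z => D (cyclicNorm z)) e he]
  have : Nonempty A := ⟨e 0⟩
  refine ⟨rowPoly_eq_of_formalMagnitude_eq hA (s := ⟨D 2, by linarith⟩) ?_ ?_ ?_ h, ?_⟩
  · exact_mod_cast h12
  · exact_mod_cast h2
  · intro a b hab
    obtain ⟨x, rfl⟩ := e.surjective a
    obtain ⟨y, rfl⟩ := e.surjective b
    have h0 : cyclicNorm (x - y) ≠ 0 := by
      rw [Ne, cyclicNorm_eq_zero, sub_eq_zero]
      rintro rfl
      exact hab rfl
    by_cases h1 : cyclicNorm (x - y) = 1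
    · left
      rw [← NNReal.coe_inj, coe_nndist, he, h1, hD1, NNReal.coe_one]
    · right
      have := hD (cyclicNorm (x - y)) (by omega) (cyclicNorm_le _)
      rw [← he, ← coe_nndist] at this
      exact this
  · rw [card_eq_of_formalMagnitude_eq hA h, ← Fintype.card_congr e, ZMod.card]

end Model

open scoped Classical in
/-- The points at distance `t`. -/
def sphereFinset {X : Type u} [MetricSpace X] [Fintype X] (t : ℝ) (x : X) : Finset X :=
  Finset.univ.filter fun y : X => dist x y = t

theorem mem_sphereFinset {X : Type u} [MetricSpace X] [Fintype X] {t : ℝ} {x y : X} :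
    y ∈ sphereFinset t x ↔ dist x y = t := by
  simp [sphereFinset]

theorem mem_sphereFinset_comm {X : Type u} [MetricSpace X] [Fintype X] {t : ℝ} (x y : X)
    (h : y ∈ sphereFinset t x) : x ∈ sphereFinset t y := by
  rw [mem_sphereFinset] at h ⊢
  rwa [dist_comm]

theorem notMem_sphereFinset_self {X : Type u} [MetricSpace X] [Fintype X] {t : ℝ} (ht : t ≠ 0)
    (x : X) : x ∉ sphereFinset t x := by
  rw [mem_sphereFinset, dist_self]
  exact ht.symm

theorem identified_of_card_le_five {A : Type v} [MetricSpace A] [Fintype A] {n : ℕ}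
    (hn : n = 4 ∨ n = 5) {D : ℕ → ℝ} (e : ZMod n ≃ A)
    (he : ∀ x y, dist (e x) (e y) = D (cyclicNorm (x - y)))
    (hD0 : D 0 = 0) (hD1 : D 1 = 1) (h12 : 1 < D 2) (h2 : D 2 ≤ 2) :
    IdentifiedByFormalMagnitude.{u, v} A := by
  intro X _ _ h
  classical
  have hc4 : (Finset.univ.filter fun z : ZMod 4 => cyclicNorm z = 1).card = 2 := by decide
  have hc5 : (Finset.univ.filter fun z : ZMod 5 => cyclicNorm z = 1).card = 2 := by decide
  have : NeZero n := ⟨by omega⟩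
  have hn2 : n / 2 = 2 := by omega
  obtain ⟨hrow, hcard⟩ := rowPoly_eq_of_cyclicModel e he hD1 h12 h2 (fun k hk hk' => by
    obtain rfl : k = 2 := by omega
    exact ⟨le_rfl, by linarith⟩) h
  have hinjD : Set.InjOn D (Set.Iic (n / 2)) := by
    rw [hn2]
    intro i hi j hj hij
    rw [Set.mem_Iic] at hi hj
    interval_cases i <;> interval_cases j <;> first | rfl | (exfalso; linarith)
  have hN : ∀ x : X, (sphereFinset 1 x).card = 2 := by
    intro x
    have := card_dist_eq e he hinjD hrow x (k := 1) (by omega) (by rw [hD1]; exact zero_le_one)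
    rw [hD1] at this
    rw [sphereFinset, this]
    rcases hn with rfl | rfl
    · exact hc4
    · exact hc5
  obtain ⟨g, hinj, hg⟩ := exists_cycle_of_card_le_five hN mem_sphereFinset_comm
    (notMem_sphereFinset_self one_ne_zero) hcard (by omega) (by omega)
  refine nonempty_isometryEquiv e he hcard hinj fun i j => ?_
  have hnorm : ∀ z : ZMod n, cyclicNorm z = 0 ∧ z = 0 ∨
      cyclicNorm z = 1 ∧ (z = 1 ∨ z = -1) ∨ cyclicNorm z = 2 ∧ z ≠ 0 ∧ z ≠ 1 ∧ z ≠ -1 := by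
    rcases hn with rfl | rfl <;> decide
  have hone : dist (g i) (g j) = 1 ↔ i - j = 1 ∨ i - j = -1 := by
    rw [← mem_sphereFinset, hg, Finset.mem_insert, Finset.mem_singleton, hinj.eq_iff,
      hinj.eq_iff]
    constructor
    · rintro (rfl | rfl)
      · left; ring
      · right; ring
    · rintro (h | h)
      · left; linear_combination -h
      · right; linear_combination -h
  rcases hnorm (i - j) with ⟨h, hz⟩ | ⟨h, hz⟩ | ⟨h, h0, h1, h1'⟩
  · rw [h, sub_eq_zero.mp hz, dist_self, hD0]
  · rw [h, hone.mpr hz, hD1]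
  · obtain ⟨k, hk, hdist⟩ := exists_dist_eq_of_rowPoly_eq e he hrow (g i) (g j)
    rw [h, hdist]
    rw [hn2] at hk
    interval_cases k
    · rw [hD0, dist_eq_zero, hinj.eq_iff] at hdist
      exact absurd (sub_eq_zero.mpr hdist) h0
    · rw [hD1, hone] at hdist
      exact absurd hdist (by tauto)
    · rfl

/-- If every `M`-degree is two, a set `T` of three points without `M`-neighbours inside `T`
cannot be complementary to a set of four points that have an `M`-neighbour outside `T`. -/
theorem not_complementary_triangle {V : Type*} [Fintype V] [DecidableEq V] {M : V → Finset V}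
    (hcard : ∀ x, (M x).card = 2) (hsymm : ∀ x y, y ∈ M x → x ∈ M y) {T : Finset V}
    (hT3 : T.card = 3) (hTc : (Tᶜ).card = 4) (hT : ∀ x ∈ T, ∀ y ∈ T, y ∉ M x)
    (hC : ∀ x ∈ Tᶜ, ∃ y ∈ Tᶜ, y ∈ M x) : False := by
  have h := Finset.sum_card_bipartiteAbove_eq_sum_card_bipartiteBelow (s := T) (t := Tᶜ)
    fun x y => y ∈ M x
  have h1 : ∀ x ∈ T, (Finset.bipartiteAbove (fun x y => y ∈ M x) Tᶜ x).card = 2 := by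
    intro x hx
    rw [← hcard x]
    congr 1
    ext y
    rw [Finset.mem_bipartiteAbove, Finset.mem_compl]
    exact ⟨fun h => h.2, fun h => ⟨fun hy => hT x hx y hy h, h⟩⟩
  have h2 : ∀ y ∈ Tᶜ, (Finset.bipartiteBelow (fun x y => y ∈ M x) T y).card ≤ 1 := by
    intro y hy
    obtain ⟨z, hz, hzy⟩ := hC y hy
    have hsub : Finset.bipartiteBelow (fun x y => y ∈ M x) T y ⊆ (M y).erase z := by
      intro x hx
      rw [Finset.mem_bipartiteBelow] at hx
      rw [Finset.mem_erase]
      refine ⟨?_, hsymm _ _ hx.2⟩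
      rintro rfl
      exact Finset.mem_compl.mp hz hx.1
    have := Finset.card_le_card hsub
    rwa [Finset.card_erase_of_mem hzy, hcard] at this
  rw [Finset.sum_congr rfl h1] at h
  -- Counting `M`-edges between `T` and its complement from both sides gives `3 * 2 ≤ 4 * 1`.
  have h3 := Finset.sum_le_sum h2
  rw [← h] at h3
  simp only [Finset.sum_const, smul_eq_mul] at h3
  omega

theorem identified_of_card_eq_seven {A : Type v} [MetricSpace A] [Fintype A]
    {D : ℕ → ℝ} (e : ZMod 7 ≃ A)
    (he : ∀ x y, dist (e x) (e y) = D (cyclicNorm (x - y)))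
    (hD0 : D 0 = 0) (hD1 : D 1 = 1) (h12 : 1 < D 2) (h2 : D 2 ≤ 2) (h3 : 2 < D 3)
    (h3' : D 3 < 1 + D 2) : IdentifiedByFormalMagnitude.{u, v} A := by
  intro X _ _ h
  classical
  obtain ⟨hrow, hcard⟩ := rowPoly_eq_of_cyclicModel e he hD1 h12 h2 (fun k hk hk' => by
    obtain rfl | rfl : k = 2 ∨ k = 3 := by omega
    · exact ⟨le_rfl, by linarith⟩
    · exact ⟨by linarith, h3'⟩) h
  have hinjD : Set.InjOn D (Set.Iic (7 / 2)) := by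
    intro i hi j hj hij
    have hi : i ≤ 3 := hi
    have hj : j ≤ 3 := hj
    interval_cases i <;> interval_cases j <;> first | rfl | (exfalso; linarith)
  have hN : ∀ x : X, (sphereFinset 1 x).card = 2 := by
    intro x
    have := card_dist_eq e he hinjD hrow x (k := 1) (by omega) (by rw [hD1]; exact zero_le_one)
    rw [hD1] at this
    rw [sphereFinset, this]
    decide
  have hM : ∀ x : X, (sphereFinset (D 2) x).card = 2 := by
    intro x
    have := card_dist_eq e he hinjD hrow x (k := 2) (by omega) (by linarith)
    rw [sphereFinset, this]
    decide
  have hdist : ∀ x y : X, x = y ∨ dist x y = 1 ∨ dist x y = D 2 ∨ dist x y = D 3 := by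
    intro x y
    obtain ⟨k, hk, hxy⟩ := exists_dist_eq_of_rowPoly_eq e he hrow x y
    have hk : k ≤ 3 := hk
    interval_cases k
    · rw [hD0, dist_eq_zero] at hxy
      exact Or.inl hxy
    · rw [hD1] at hxy
      tauto
    · tauto
    · tauto
  -- Two unit steps cover a distance of at most `2 < D 3`, which leaves only `D 2`.
  have htwo : ∀ x y z : X, dist x y = 1 → dist y z = 1 → x ≠ z → dist x z ≠ 1 →
      dist x z = D 2 := by
    intro x y z hxy hyz hne h1
    have ht := dist_triangle x y z
    rcases hdist x z with h | h | h | h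
    · exact absurd h hne
    · exact absurd h h1
    · exact h
    · linarith
  have hone : ∀ {m : ℕ} {g : ZMod m → X}, Function.Injective g →
      (∀ z, sphereFinset 1 (g z) = {g (z - 1), g (z + 1)}) →
      ∀ i j, dist (g i) (g j) = 1 ↔ i - j = 1 ∨ i - j = -1 := by
    intro m g hinj hg i j
    rw [← mem_sphereFinset, hg, Finset.mem_insert, Finset.mem_singleton, hinj.eq_iff,
      hinj.eq_iff]
    constructor
    · rintro (rfl | rfl)
      · left; ring
      · right; ring
    · rintro (h | h)
      · left; linear_combination -h
      · right; linear_combination -h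
  have hirr : ∀ x : X, x ∉ sphereFinset 1 x := notMem_sphereFinset_self one_ne_zero
  have hskip : ∀ {m : ℕ} {g : ZMod m → X}, Function.Injective g →
      (∀ z, sphereFinset 1 (g z) = {g (z - 1), g (z + 1)}) →
      (2 : ZMod m) ≠ 0 → (2 : ZMod m) ≠ 1 → (2 : ZMod m) ≠ -1 →
      ∀ i, dist (g i) (g (i + 2)) = D 2 := by
    intro m g hinj hg h0 h1 h1' i
    refine htwo _ (g (i + 1)) _ ?_ ?_ ?_ ?_
    · rw [hone hinj hg]
      right; ring
    · rw [hone hinj hg]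
      right; ring
    · rw [Ne, hinj.eq_iff]
      exact fun h => h0 (left_eq_add.mp h)
    · rw [Ne, hone hinj hg]
      rintro (h | h)
      · exact h1' (by linear_combination -h)
      · exact h1 (by linear_combination -h)
  rcases exists_cycle_of_card_eq_seven hN mem_sphereFinset_comm hirr hcard with
    ⟨g, hinj, hg⟩ | ⟨g, hinj, hg⟩
  · have hg2 := hskip hinj hg (by decide) (by decide) (by decide)
    refine nonempty_isometryEquiv e he hcard hinj fun i j => ?_
    have hnorm : ∀ z : ZMod 7, cyclicNorm z = 0 ∧ z = 0 ∨
        cyclicNorm z = 1 ∧ (z = 1 ∨ z = -1) ∨ cyclicNorm z = 2 ∧ (z = 2 ∨ z = -2) ∨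
        cyclicNorm z = 3 ∧ z ≠ 0 ∧ z ≠ 1 ∧ z ≠ -1 ∧ z ≠ 2 ∧ z ≠ -2 := by
      decide
    rcases hnorm (i - j) with ⟨h, hz⟩ | ⟨h, hz⟩ | ⟨h, hz⟩ | ⟨h, h0, h1, h1', h2, h2'⟩
    · rw [h, sub_eq_zero.mp hz, dist_self, hD0]
    · rw [h, (hone hinj hg i j).mpr hz, hD1]
    · rw [h]
      rcases hz with hz | hz
      · rw [show i = j + 2 by linear_combination hz, dist_comm]
        exact hg2 j
      · rw [show j = i + 2 by linear_combination -hz]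
        exact hg2 i
    · rw [h]
      rcases hdist (g i) (g j) with h | h | h | h
      · exact absurd (sub_eq_zero.mpr (hinj h)) h0
      · exact absurd ((hone hinj hg i j).mp h) (by tauto)
      · exfalso
        -- The sphere of radius `D 2` has only two points, already used up by `g (i - 2)` and `g (i
        -- + 2)`; all remaining distances must be `D 3`.
        have hset : ({g (i - 2), g (i + 2)} : Finset X) = sphereFinset (D 2) (g i) := by
          apply Finset.eq_of_subset_of_card_le
          · rw [Finset.insert_subset_iff, Finset.singleton_subset_iff, mem_sphereFinset,
              mem_sphereFinset]
            refine ⟨?_, hg2 i⟩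
            have := hg2 (i - 2)
            rwa [sub_add_cancel, dist_comm] at this
          · rw [hM, Finset.card_pair]
            rw [Ne, hinj.eq_iff]
            intro h
            have : (4 : ZMod 7) = 0 := by linear_combination -h
            exact absurd this (by decide)
        have hmem : g j ∈ ({g (i - 2), g (i + 2)} : Finset X) := by
          rw [hset, mem_sphereFinset]
          exact h
        rw [Finset.mem_insert, Finset.mem_singleton, hinj.eq_iff, hinj.eq_iff] at hmem
        rcases hmem with rfl | rfl
        · exact h2 (by ring)
        · exact h2' (by ring)
      · exact h
  · exfalso
    have hg2 := hskip hinj hg (by decide) (by decide) (by decide)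
    have hC := card_image_cycle hinj
    have hclosed := closed_compl mem_sphereFinset_comm (closed_image hg)
    have hT3 : ((Finset.univ.image g)ᶜ).card = 3 := by
      rw [Finset.card_compl, hC, hcard]
    -- The three points off the 4-cycle are pairwise at distance `1`, while opposite vertices of the
    -- 4-cycle are at distance `D 2`.
    refine not_complementary_triangle hM mem_sphereFinset_comm hT3
      (by rw [compl_compl, hC]) ?_ ?_
    · intro x hx y hy hxy
      have h1 : insert x (sphereFinset 1 x) = (Finset.univ.image g)ᶜ := by
        apply Finset.eq_of_subset_of_card_le
        · exact Finset.insert_subset hx (hclosed x hx)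
        · rw [hT3, Finset.card_insert_of_notMem (hirr x), hN]
      rw [← h1, Finset.mem_insert, mem_sphereFinset] at hy
      rw [mem_sphereFinset] at hxy
      rcases hy with rfl | hy
      · rw [dist_self] at hxy
        linarith
      · linarith
    · rw [compl_compl]
      intro x hx
      obtain ⟨i, _, rfl⟩ := Finset.mem_image.mp hx
      exact ⟨g (i + 2), Finset.mem_image_of_mem _ (Finset.mem_univ _),
        mem_sphereFinset.mpr (hg2 i)⟩

theorem one_lt_chord_two {n : ℕ} (hn : 4 ≤ n) : 1 < chord n 2 := by
  rw [← chord_one (n := n) (by omega)]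
  exact chord_lt_chord (by omega) (by omega) (by omega)

theorem chord_two_le {n : ℕ} (hn : 2 ≤ n) : chord n 2 ≤ 2 := by
  have h := chord_add_le (n := n) (i := 1) (j := 1) hn (by omega) (by omega)
  rw [chord_one hn] at h
  linarith

/-- By the triple-angle formula the ratio is `3 - 4 s ^ 2` with `s = sin (π / 7)`, and `s < sin (π /
6) = 1 / 2`. -/
theorem two_lt_chord_seven_three : 2 < chord 7 3 := by
  have hpos := sin_pi_div_pos (n := 7) (by omega)
  have hlt : Real.sin (Real.pi / (7 : ℕ)) < 1 / 2 := by
    rw [← Real.sin_pi_div_six]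
    have hpi := Real.pi_pos
    push_cast
    exact Real.sin_lt_sin_of_lt_of_le_pi_div_two (by linarith) (by linarith) (by linarith)
  have h3 : Real.pi * (3 : ℕ) / (7 : ℕ) = 3 * (Real.pi / (7 : ℕ)) := by
    push_cast
    ring
  rw [chord, h3, Real.sin_three_mul, lt_div_iff₀ hpos]
  nlinarith [mul_pos hpos (sub_pos.mpr hlt), mul_pos hpos (mul_pos (sub_pos.mpr hlt) hpos)]

theorem chord_seven_three_lt : chord 7 3 < 1 + chord 7 2 := by
  have hpi := Real.pi_pos
  have hpos := sin_pi_div_pos (n := 7) (by omega)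
  rw [← chord_one (n := 7) (by omega), chord, chord, chord, ← add_div]
  refine div_lt_div_of_pos_right ?_ hpos
  have h3 : Real.pi * (3 : ℕ) / (7 : ℕ) =
      Real.pi * (1 : ℕ) / (7 : ℕ) + Real.pi * (2 : ℕ) / (7 : ℕ) := by
    push_cast
    ring
  have h1 : Real.pi * (1 : ℕ) / (7 : ℕ) = Real.pi / (7 : ℕ) := by
    push_cast
    ring
  have h2pos : 0 ≤ Real.sin (Real.pi * (2 : ℕ) / (7 : ℕ)) := by
    apply Real.sin_nonneg_of_nonneg_of_le_pi
    · positivity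
    · push_cast
      linarith
  have hcos : Real.cos (Real.pi * (2 : ℕ) / (7 : ℕ)) < 1 := by
    rw [← Real.cos_zero]
    apply Real.cos_lt_cos_of_nonneg_of_le_pi le_rfl
    · push_cast
      linarith
    · push_cast
      linarith
  rw [h3, Real.sin_add, h1]
  nlinarith [Real.cos_le_one (Real.pi / (7 : ℕ)), mul_pos hpos (sub_pos.mpr hcos)]

theorem identified_regularPolygon {n : ℕ} (hn : n = 4 ∨ n = 5 ∨ n = 7) :
    IdentifiedByFormalMagnitude.{u, 0} (RegularPolygon n) := by
  have h2 : 2 ≤ n := by omega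
  have h4 : 4 ≤ n := by omega
  obtain ⟨e, he⟩ := exists_regularPolygon_equiv h2
  rw [← or_assoc] at hn
  rcases hn with hn | rfl
  · exact identified_of_card_le_five hn e he (chord_zero n) (chord_one h2) (one_lt_chord_two h4)
      (chord_two_le h2)
  · exact identified_of_card_eq_seven e he (chord_zero 7) (chord_one h2) (one_lt_chord_two h4)
      (chord_two_le h2) two_lt_chord_seven_three chord_seven_three_lt

theorem identified_cycleSpace {n : ℕ} (hn : n = 4 ∨ n = 5) :
    IdentifiedByFormalMagnitude.{u, 0} (CycleSpace n) := by
  obtain ⟨e, he⟩ := exists_cycleSpace_equiv (n := n) (by omega)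
  exact identified_of_card_le_five hn (D := fun k => (k : ℝ)) e he (by simp) (by simp)
    (by simp) (by simp)

end Identified

end

theorem mainTheorem1 :
    (∀ n : ℕ, n = 4 ∨ n = 5 ∨ n = 7 →
      IdentifiedByFormalMagnitude.{u, 0} (RegularPolygon n)) ∧
    (∀ n : ℕ, n = 9 ∨ (Even n ∧ 6 ≤ n) →
      ¬ IdentifiedByFormalMagnitude.{u, 0} (RegularPolygon n)) ∧
    (∀ n : ℕ, n = 4 ∨ n = 5 →
      IdentifiedByFormalMagnitude.{u, 0} (CycleSpace n)) ∧
    (∀ n : ℕ, Even n ∧ 6 ≤ n →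
      ¬ IdentifiedByFormalMagnitude.{u, 0} (CycleSpace n)) := by
  refine ⟨fun n hn => identified_regularPolygon hn, ?_, fun n hn => identified_cycleSpace hn,
    fun n hn => not_identified_cycleSpace hn⟩
  rintro n (rfl | hn)
  · exact not_identified_regularPolygon_nine
  · exact not_identified_regularPolygon_of_even hn
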